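/- Let $\mathbb T$ be a Galton--Watson tree with root $\varnothing$ whose offspring number $\nu$ satisfies $\mathbb P(\nu=0)=0$ and $1<m:=\mathbb E[\nu]<\infty$. Let $\mathbb T_n$ be the set of vertices at depth $n$, and let $W:=\lim_{n\to\infty} m^{-n}\#\mathbb T_n$. Conditionally on $\mathbb T$, let $\{\xi(e)\}$, indexed by the edges $e$ of $\mathbb T$, be i.i.d. copies of an almost surely positive random variable $\xi$. Fix $\lambda>m$, and assign to each edge $e$ the resistance $\lambda^{d(e)}\xi(e)$, where the depth $d(e)$ is the distance from the root to the farther endpoint of $e$. For $n\ge 1$ let $C_n(\lambda)$ be the effective conductance between $\varnothing$ and $\mathbb T_n$ in this network, that is, $C_n(\lambda)^{-1}=\inf_\theta\sum_e \lambda^{d(e)}\xi(e)\,\theta(e)^2$, where the infimum is over all flows $\theta$ of unit strength from $\{\varnothing\}$ to $\mathbb T_n$. (i) If $\mathbb E[\xi+\xi^{-1}+\nu^2]<\infty$, then $W$ exists almost surely as a finite limit, $0<\mathbb E[C_n(\lambda)]<\infty$ for all $n\ge 1$, and $$\frac{C_n(\lambda)}{\mathbb E[C_n(\lambda)]}\longrightarrow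 W\qquad\text{almost surely as } n\to\infty .$$ (ii) If $\mathbb E[\xi^2+\xi^{-1}+\nu^3]<\infty$, then $\mathbb E[C_n(\lambda)]<\infty$ for all $n\ge 1$, and, as $n\to\infty$, $\left(\frac{\lambda}{m}\right)^n\mathbb E[C_n(\lambda)]$ converges to a finite and strictly positive limit. -/

import Mathlib

open MeasureTheory ProbabilityTheory Filter Topology
open scoped ENNReal

noncomputable section

/-! ### Electric networks and Thomson's principle -/

/-- A flow on the graph `G`: an antisymmetric function on the directed edges. It is extended by `0`
to the pairs of vertices that are not adjacent. -/
structure NetworkFlow {V : Type*} (G : SimpleGraph V) where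
  /-- the amount `θ x y` that flows through the directed edge from `x` to `y` -/
  toFun : V → V → ℝ
  antisymm : ∀ x y, toFun x y = -toFun y x
  eq_zero_of_not_adj : ∀ x y, ¬ G.Adj x y → toFun x y = 0

namespace NetworkFlow

variable {V : Type*} {G : SimpleGraph V}

/-- The divergence of a flow at `x` (the graph being locally finite). -/
def div (θ : NetworkFlow G) (x : V) : ℝ :=
  ∑ᶠ (y : V) (_ : G.Adj x y), θ.toFun x y

/-- `θ` is a flow from `A` to `Z` of unit strength, for finite disjoint sets `A`, `Z`: the node law
holds outside `A ∪ Z`, the flow out of `A` is `1` and the flow into `Z` is `1`. -/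
structure IsUnitFlow (θ : NetworkFlow G) (A Z : Set V) : Prop where
  node_law : ∀ x, x ∉ A ∪ Z → θ.div x = 0
  flow_out : ∑ᶠ (a : V) (_ : a ∈ A), ∑ᶠ (y : V) (_ : G.Adj a y ∧ y ∉ A), θ.toFun a y = 1
  flow_in : ∑ᶠ (z : V) (_ : z ∈ Z), ∑ᶠ (y : V) (_ : G.Adj z y ∧ y ∉ Z), θ.toFun y z = 1

/-- The square `θ(e)²` of the flow through an undirected edge `e`. -/
def edgeSq (θ : NetworkFlow G) : Sym2 V → ℝ :=
  Sym2.lift ⟨fun x y => θ.toFun x y ^ 2, fun x y => by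
    change θ.toFun x y ^ 2 = θ.toFun y x ^ 2
    rw [θ.antisymm x y, neg_sq]⟩

/-- The energy `∑ r(e) θ(e)²` of a flow, the sum being over the undirected edges of `G`. -/
def energy (θ : NetworkFlow G) (r : Sym2 V → ℝ) : ℝ≥0∞ :=
  ∑' e : G.edgeSet, ENNReal.ofReal (r e * θ.edgeSq e)

end NetworkFlow

/-- The effective resistance between `A` and `Z` in the network `(G, r)`: the infimum of the energy
over all flows of unit strength from `A` to `Z`. -/
def effectiveResistance {V : Type*} (G : SimpleGraph V) (r : Sym2 V → ℝ) (A Z : Set V) : ℝ≥0∞ :=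
  ⨅ (θ : NetworkFlow G) (_ : θ.IsUnitFlow A Z), θ.energy r

/-- The effective conductance is the reciprocal of the effective resistance. -/
def effectiveConductance {V : Type*} (G : SimpleGraph V) (r : Sym2 V → ℝ) (A Z : Set V) : ℝ≥0∞ :=
  (effectiveResistance G r A Z)⁻¹

/-! ### Rooted trees of words -/

/-- The rooted tree in which the vertex `u` has `k u` children: its vertices are the words
`[i₁, …, iₙ]` such that each letter `i` that follows a prefix `u` satisfies `i < k u`.
The root is the empty word, the children of `u` are `u ++ [0], …, u ++ [k u - 1]`, and the depth
of a vertex is its length. -/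
def wordTree (k : List ℕ → ℕ) : Set (List ℕ) :=
  {x | ∀ u i, (u ++ [i]) <+: x → i < k u}

/-- The `n`-th level of the tree. -/
def treeLevel (k : List ℕ → ℕ) (n : ℕ) : Set (List ℕ) :=
  {x | x ∈ wordTree k ∧ x.length = n}

/-- The tree as a graph: a vertex is joined to each of its children. Words that are not vertices of
the tree are isolated points of the graph, and so do not matter for flows. -/
def treeGraph (k : List ℕ → ℕ) : SimpleGraph (List ℕ) where
  Adj x y := x ∈ wordTree k ∧ y ∈ wordTree k ∧ ((∃ i, y = x ++ [i]) ∨ (∃ i, x = y ++ [i]))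
  symm := ⟨fun _ _ h => ⟨h.2.1, h.1, h.2.2.symm⟩⟩
  loopless := ⟨fun x h => by
    rcases h.2.2 with ⟨i, hi⟩ | ⟨i, hi⟩ <;> simpa using congrArg List.length hi⟩

/-- The resistance `lam ^ d(e) * ξ(e)` of the edge `e` that joins `x` to its parent, where
`d(e)` is the length of `x` and `ξ(e) = s x`. (On pairs of words of the same length, which are never
edges, the value is `0`.) -/
def edgeResistance (lam : ℝ) (s : List ℕ → ℝ) : Sym2 (List ℕ) → ℝ :=
  Sym2.lift ⟨fun x y =>
      if x.length < y.length then lam ^ y.length * s y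
      else if y.length < x.length then lam ^ x.length * s x
      else 0,
    fun x y => by
      rcases lt_trichotomy x.length y.length with h | h | h
      · simp [h, h.not_gt]
      · simp [h]
      · simp [h, h.not_gt]⟩

/-! ### Branching random networks -/

/-- The random variables of a branching random network, with values in the full tree of words:
`ν x` is the number of children of the vertex `x`, and `ξ x`, for a nonempty word `x`, is the
random factor of the resistance of the edge that joins `x` to its parent. The variables `ν x` are
i.i.d., the variables `ξ x` are i.i.d., and the two families are independent of each other.
The variable `ξ []` belongs to no edge, and is used as a generic copy of the `ξ x`; likewise
`ν []`, the number of children of the root, is a generic copy of the `ν x`. -/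
structure IsBranchingNetwork {Ω : Type*} [MeasurableSpace Ω] (P : Measure Ω)
    (ν : List ℕ → Ω → ℕ) (ξ : List ℕ → Ω → ℝ) : Prop where
  measurable_offspring : ∀ x, Measurable (ν x)
  measurable_factor : ∀ x, Measurable (ξ x)
  identDistrib_offspring : ∀ x, IdentDistrib (ν x) (ν []) P P
  identDistrib_factor : ∀ x, IdentDistrib (ξ x) (ξ []) P P
  iIndepFun_offspring : iIndepFun ν P
  iIndepFun_factor : iIndepFun ξ P
  indepFun : IndepFun (fun ω x => ν x ω) (fun ω x => ξ x ω) P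

/-- The effective conductance `C_n(lam)` between the root and the `n`-th level of the tree
(for `1 ≤ n`), when each edge `e` is given the resistance `lam ^ d(e) * ξ(e)`. -/
def levelConductance {Ω : Type*} (ν : List ℕ → Ω → ℕ) (ξ : List ℕ → Ω → ℝ)
    (lam : ℝ) (n : ℕ) (ω : Ω) : ℝ :=
  (effectiveConductance (treeGraph fun x => ν x ω) (edgeResistance lam fun x => ξ x ω)
    {[]} (treeLevel (fun x => ν x ω) n)).toReal

/-- The size of the `n`-th level of the tree, divided by `m ^ n`. -/
def normalizedLevelSize {Ω : Type*} (ν : List ℕ → Ω → ℕ) (m : ℝ) (n : ℕ) (ω : Ω) : ℝ :=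
  ((treeLevel (fun x => ν x ω) n).ncard : ℝ) / m ^ n

/-- The limit `W` of the normalized level sizes. -/
def levelSizeLimit {Ω : Type*} (ν : List ℕ → Ω → ℕ) (m : ℝ) (ω : Ω) : ℝ :=
  limUnder atTop fun n => normalizedLevelSize ν m n ω

end

/-! Write $A_n$ for the conductance $C_{n+1}(\lambda)$ and $\rho=m/\lambda<1$. The resistances below
a child of the root are those of a copy of the network multiplied by $\lambda$, so the series and
parallel laws give $A_{n+1}=\lambda^{-1}\sum_i D_n(i)$, the sum being over the children $i$ of the
root, with $D_n=A_n/(1+sA_n)$ and $s$ the factor of the edge above, independent of $A_n$. The whole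
analysis is done for this recursion in an abstract self-similar environment, `BranchingSystem`;
`TreeEnv.effectiveConductance_treeLevel` identifies it with Thomson's variational definition.

Means. Since $D_n\le A_n$, the sequence $\alpha_n=\rho^{-n}E[A_n]$ decreases. The loss $A_n-D_n$ is
at most $sA_n^2$, so everything rests on showing that $E[A_n^2]/E[A_n]$ is $O(\rho^n)$
(`exists_integral_sq_le`). The crucial fact is `integral_sq_seriesConductance_le`: a series edge
independent of the network does not increase this ratio. Taking the sum over the children then
multiplies the ratio by at most $\lambda^{-1}<\rho$, up to an error of order $E[A_n]=O(\rho^n)$.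
Hence $\alpha_n-\alpha_{n+1}\le K\rho^n\alpha_n$, and $\alpha_n$ tends to a positive limit.

Almost sure convergence. Shorting the first $k$ levels bounds $A_{n+k}$ by
$\lambda^{-k}\sum_{|x|=k}A_n(x)$. After normalization the error is nonnegative with mean
$\alpha_n-\alpha_{n+k}=O(\rho^n)$. Replacing each $A_n(x)$ by its mean costs a centred sum over
level $k$, of normalized second moment $O(m^{-k})$ for $n\ge1$. With $n$ and $k$ both about $j/2$,
these two errors are summable in $j$, so $\rho^{-j}A_j-\alpha_{j/2}W_{j-j/2}\to0$ almost surely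
(`ae_tendsto_sub`), where $W_k$ is the normalized size of level $k$. The same second moment bound
for centred sums gives the convergence of $W_k$. -/

noncomputable section

/-! ### Branching systems -/

/-- A self-similar random environment: `N` is the number of children of the root, `σ i` the
environment seen from the `i`-th child, and `s` a mark attached to the root. -/
structure BranchingSystem {E : Type*} [MeasurableSpace E] (μ : Measure E)
    (N : E → ℕ) (s : E → ℝ) (σ : ℕ → E → E) : Prop where
  measurable_card : Measurable N
  measurable_mark : Measurable s
  shift : ∀ i, MeasurePreserving (σ i) μ μ
  indep_shift : Pairwise fun i j => IndepFun (σ i) (σ j) μ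
  indep_card : IndepFun N (fun e i => σ i e) μ
  indep_mark : IndepFun s (fun e => (N e, fun i => σ i e)) μ

/-- The sum of `g` over the environments seen from the children of the root. -/
def offspringSum {E : Type*} (N : E → ℕ) (σ : ℕ → E → E) (g : E → ℝ) (e : E) : ℝ :=
  ∑ i ∈ Finset.range (N e), g (σ i e)

section OffspringSum

variable {E : Type*} {N : E → ℕ} {σ : ℕ → E → E} {g h : E → ℝ}

lemma offspringSum_const_mul (c : ℝ) :
    offspringSum N σ (fun e => c * g e) = fun e => c * offspringSum N σ g e := by
  ext e; simp [offspringSum, Finset.mul_sum]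

lemma offspringSum_sub :
    offspringSum N σ (fun e => g e - h e) =
      fun e => offspringSum N σ g e - offspringSum N σ h e := by
  ext e; simp [offspringSum]

lemma offspringSum_one : offspringSum N σ (fun _ => 1) = fun e => (N e : ℝ) := by
  ext e; simp [offspringSum]

lemma offspringSum_iterate_sub_const_mul (k : ℕ) (c : ℝ) :
    (offspringSum N σ)^[k] (fun e => g e - c * h e) =
      fun e => (offspringSum N σ)^[k] g e - c * (offspringSum N σ)^[k] h e := by
  induction k with
  | zero => rfl
  | succ k ih =>
    simp only [Function.iterate_succ_apply', ih]
    rw [offspringSum_sub, offspringSum_const_mul]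

end OffspringSum

/-! ### First and second moments of sums over the children and over the levels. -/

namespace BranchingSystem

variable {E : Type*} [MeasurableSpace E] {μ : Measure E} {N : E → ℕ} {s : E → ℝ} {σ : ℕ → E → E}

lemma measurable_sum_range {g : E → ℝ} (hg : Measurable g) :
    Measurable fun p : ℕ × (ℕ → E) => ∑ i ∈ Finset.range p.1, g (p.2 i) :=
  measurable_from_prod_countable_right fun n => by
    dsimp only; fun_prop

lemma measurable_pair (S : BranchingSystem μ N s σ) :
    Measurable fun e => (N e, fun i => σ i e) :=
  S.measurable_card.prodMk (measurable_pi_iff.2 fun i => (S.shift i).measurable)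

lemma measurable_offspringSum (S : BranchingSystem μ N s σ) {g : E → ℝ} (hg : Measurable g) :
    Measurable (offspringSum N σ g) :=
  (measurable_sum_range hg).comp S.measurable_pair

lemma indepFun_mark_offspringSum (S : BranchingSystem μ N s σ) {g : E → ℝ} (hg : Measurable g) :
    IndepFun s (offspringSum N σ g) μ :=
  S.indep_mark.comp measurable_id (measurable_sum_range hg)

lemma offspringSum_mono_ae (S : BranchingSystem μ N s σ) {g h : E → ℝ} (hgh : g ≤ᵐ[μ] h) :
    offspringSum N σ g ≤ᵐ[μ] offspringSum N σ h := by
  have H : ∀ᵐ e ∂μ, ∀ i, g (σ i e) ≤ h (σ i e) :=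
    ae_all_iff.2 fun i => (S.shift i).quasiMeasurePreserving.ae hgh
  filter_upwards [H] with e he
  exact Finset.sum_le_sum fun i _ => he i

lemma offspringSum_pos_ae (S : BranchingSystem μ N s σ) (hN : ∀ᵐ e ∂μ, N e ≠ 0) {g : E → ℝ}
    (hg : ∀ᵐ e ∂μ, 0 < g e) : ∀ᵐ e ∂μ, 0 < offspringSum N σ g e := by
  have H : ∀ᵐ e ∂μ, ∀ i, 0 < g (σ i e) :=
    ae_all_iff.2 fun i => (S.shift i).quasiMeasurePreserving.ae hg
  filter_upwards [H, hN] with e he hn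
  exact Finset.sum_pos (fun i _ => he i) (by simpa using hn)

lemma integrable_comp_shift (S : BranchingSystem μ N s σ) {g : E → ℝ} (hg : Integrable g μ)
    (i : ℕ) : Integrable (fun e => g (σ i e)) μ :=
  (S.shift i).integrable_comp_of_integrable hg

lemma integral_comp_shift (S : BranchingSystem μ N s σ) {g : E → ℝ} (hg : Measurable g)
    (i : ℕ) : ∫ e, g (σ i e) ∂μ = ∫ e, g e ∂μ := by
  conv_rhs => rw [← (S.shift i).map_eq]
  rw [integral_map (S.shift i).measurable.aemeasurable hg.aestronglyMeasurable]

lemma memLp_comp_shift (S : BranchingSystem μ N s σ) {g : E → ℝ} (hg : MemLp g 2 μ)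
    (i : ℕ) : MemLp (fun e => g (σ i e)) 2 μ :=
  hg.comp_measurePreserving (S.shift i)

lemma measurable_iterate (S : BranchingSystem μ N s σ) {g : E → ℝ} (hg : Measurable g) (k : ℕ) :
    Measurable ((offspringSum N σ)^[k] g) := by
  induction k with
  | zero => exact hg
  | succ k ih => rw [Function.iterate_succ_apply']; exact S.measurable_offspringSum ih

variable [IsProbabilityMeasure μ]

/-- Integration of a function of the number of children and of the environments seen from
them: one may first average over these environments, with the number of children fixed. -/
lemma integral_card_shift (S : BranchingSystem μ N s σ) {F : ℕ × (ℕ → E) → ℝ}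
    (hF : Measurable F) (h₁ : ∀ n, Integrable (fun e => F (n, fun i => σ i e)) μ)
    (h₂ : Integrable (fun e => ∫ e', ‖F (N e, fun i => σ i e')‖ ∂μ) μ) :
    Integrable (fun e => F (N e, fun i => σ i e)) μ ∧
      ∫ e, F (N e, fun i => σ i e) ∂μ = ∫ e, ∫ e', F (N e, fun i => σ i e') ∂μ ∂μ := by
  have hτ : Measurable fun e i => σ i e := measurable_pi_iff.2 fun i => (S.shift i).measurable
  have hN := S.measurable_card
  -- The number of children is independent of the environments below it, so their joint law is a
  -- product and Fubini applies.
  have hmap := (indepFun_iff_map_prod_eq_prod_map_map hN.aemeasurable hτ.aemeasurable).1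
    S.indep_card
  have : IsProbabilityMeasure (μ.map fun e i => σ i e) :=
    Measure.isProbabilityMeasure_map hτ.aemeasurable
  have : IsProbabilityMeasure (μ.map N) := Measure.isProbabilityMeasure_map hN.aemeasurable
  have hsec : ∀ n, Measurable fun τ => F (n, τ) := fun n => hF.comp (by fun_prop)
  have hint : Integrable F (μ.map fun e => (N e, fun i => σ i e)) := by
    rw [hmap, integrable_prod_iff hF.aestronglyMeasurable]
    refine ⟨.of_forall fun n =>
      (integrable_map_measure (hsec n).aestronglyMeasurable hτ.aemeasurable).2 (h₁ n), ?_⟩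
    rw [integrable_map_measure (Measurable.of_discrete).aestronglyMeasurable hN.aemeasurable]
    refine h₂.congr (.of_forall fun e => ?_)
    simp only [Function.comp_apply]
    rw [integral_map hτ.aemeasurable (hsec _).norm.aestronglyMeasurable]
  refine ⟨(integrable_map_measure hF.aestronglyMeasurable S.measurable_pair.aemeasurable).1 hint,
    ?_⟩
  have h := integral_map (μ := μ) S.measurable_pair.aemeasurable hF.aestronglyMeasurable
  rw [← h, hmap, integral_prod _ (hmap ▸ hint), integral_map hN.aemeasurable
    (Measurable.of_discrete).aestronglyMeasurable]
  refine integral_congr_ae (.of_forall fun e => ?_)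
  dsimp only
  rw [integral_map hτ.aemeasurable (hsec _).aestronglyMeasurable]

lemma integrable_offspringSum (S : BranchingSystem μ N s σ)
    (hN : Integrable (fun e => (N e : ℝ)) μ) {g : E → ℝ} (hgm : Measurable g)
    (hg : Integrable g μ) :
    Integrable (offspringSum N σ g) μ ∧
      ∫ e, offspringSum N σ g e ∂μ = (∫ e, (N e : ℝ) ∂μ) * ∫ e, g e ∂μ := by
  have h₁ : ∀ n, Integrable (fun e => ∑ i ∈ Finset.range n, g (σ i e)) μ := fun n =>
    integrable_finsetSum _ fun i _ => S.integrable_comp_shift hg i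
  have h₂ : Integrable (fun e => ∫ e', ‖∑ i ∈ Finset.range (N e), g (σ i e')‖ ∂μ) μ := by
    refine (hN.mul_const (∫ e, ‖g e‖ ∂μ)).mono'
      (Measurable.comp (g := fun n => ∫ e', ‖∑ i ∈ Finset.range n, g (σ i e')‖ ∂μ)
        Measurable.of_discrete S.measurable_card).aestronglyMeasurable (.of_forall fun e => ?_)
    rw [Real.norm_of_nonneg (integral_nonneg fun _ => norm_nonneg _)]
    calc ∫ e', ‖∑ i ∈ Finset.range (N e), g (σ i e')‖ ∂μ
        ≤ ∫ e', ∑ i ∈ Finset.range (N e), ‖g (σ i e')‖ ∂μ :=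
          integral_mono (h₁ _).norm
            (integrable_finsetSum _ fun i _ => (S.integrable_comp_shift hg i).norm)
            fun e' => norm_sum_le _ _
      _ = N e * ∫ e, ‖g e‖ ∂μ := by
          rw [integral_finsetSum _ fun i _ => (S.integrable_comp_shift hg i).norm]
          simp only [fun i => S.integral_comp_shift (g := fun e => ‖g e‖) hgm.norm i,
            Finset.sum_const, Finset.card_range, nsmul_eq_mul]
  obtain ⟨hi, he⟩ := S.integral_card_shift (measurable_sum_range hgm) h₁ h₂
  refine ⟨hi, he.trans ?_⟩
  rw [← integral_mul_const]
  refine integral_congr_ae (.of_forall fun e => ?_)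
  dsimp only
  rw [integral_finsetSum _ fun i _ => S.integrable_comp_shift hg i]
  simp [fun i => S.integral_comp_shift hgm i]

/-- Pairwise independence of the shifts already makes variances additive; the second moment is the
variance plus the squared mean. -/
lemma integral_sq_sum_range (S : BranchingSystem μ N s σ) {g : E → ℝ} (hgm : Measurable g)
    (hg : MemLp g 2 μ) (n : ℕ) :
    ∫ e, (∑ i ∈ Finset.range n, g (σ i e)) ^ 2 ∂μ =
      n * (∫ e, g e ^ 2 ∂μ - (∫ e, g e ∂μ) ^ 2) + n ^ 2 * (∫ e, g e ∂μ) ^ 2 := by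
  have hL : MemLp (fun e => ∑ i ∈ Finset.range n, g (σ i e)) 2 μ :=
    memLp_finsetSum _ fun i _ => S.memLp_comp_shift hg i
  have hv := IndepFun.variance_sum (X := fun i e => g (σ i e)) (s := Finset.range n)
    (fun i _ => S.memLp_comp_shift hg i)
    (fun i _ j _ hij => (S.indep_shift hij).comp hgm hgm)
  have hsum : (∑ i ∈ Finset.range n, fun e => g (σ i e)) =
      fun e => ∑ i ∈ Finset.range n, g (σ i e) := by
    ext e; simp
  rw [hsum, variance_eq_sub hL] at hv
  have hvi : ∀ i, variance (fun e => g (σ i e)) μ =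
      ∫ e, g e ^ 2 ∂μ - (∫ e, g e ∂μ) ^ 2 := fun i => by
    rw [variance_eq_sub (S.memLp_comp_shift hg i), S.integral_comp_shift hgm]
    congr 1
    exact S.integral_comp_shift (g := fun e => g e ^ 2) (hgm.pow_const 2) i
  simp only [hvi, Finset.sum_const, Finset.card_range, nsmul_eq_mul] at hv
  have hm : ∫ e, ∑ i ∈ Finset.range n, g (σ i e) ∂μ = n * ∫ e, g e ∂μ := by
    rw [integral_finsetSum _ fun i _ =>
      (S.memLp_comp_shift hg i).integrable (by norm_num)]
    simp [fun i => S.integral_comp_shift hgm i]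
  rw [hm] at hv
  have : ∫ e, (∑ i ∈ Finset.range n, g (σ i e)) ^ 2 ∂μ =
      ∫ e, ((fun e => ∑ i ∈ Finset.range n, g (σ i e)) ^ 2) e ∂μ := rfl
  rw [this]
  linarith

lemma memLp_offspringSum (S : BranchingSystem μ N s σ)
    (hN : MemLp (fun e => (N e : ℝ)) 2 μ) {g : E → ℝ} (hgm : Measurable g)
    (hg : MemLp g 2 μ) :
    MemLp (offspringSum N σ g) 2 μ ∧
      ∫ e, offspringSum N σ g e ^ 2 ∂μ =
        (∫ e, (N e : ℝ) ∂μ) * (∫ e, g e ^ 2 ∂μ - (∫ e, g e ∂μ) ^ 2) +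
          (∫ e, (N e : ℝ) ^ 2 ∂μ) * (∫ e, g e ∂μ) ^ 2 := by
  have hi₁ : Integrable (fun e => (N e : ℝ)) μ := hN.integrable (by norm_num)
  have hi₂ : Integrable (fun e => (N e : ℝ) ^ 2) μ := hN.integrable_sq
  have hF : Measurable fun p : ℕ × (ℕ → E) => (∑ i ∈ Finset.range p.1, g (p.2 i)) ^ 2 :=
    (measurable_sum_range hgm).pow_const 2
  have h₁ : ∀ n, Integrable (fun e => (∑ i ∈ Finset.range n, g (σ i e)) ^ 2) μ := fun n =>
    (memLp_finsetSum _ fun i _ => S.memLp_comp_shift hg i).integrable_sq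
  have hI : Integrable (fun e => (N e : ℝ) * (∫ e, g e ^ 2 ∂μ - (∫ e, g e ∂μ) ^ 2) +
      (N e : ℝ) ^ 2 * (∫ e, g e ∂μ) ^ 2) μ := (hi₁.mul_const _).add (hi₂.mul_const _)
  -- The integrand is a square, so its norm is itself and the integrability condition is read off
  -- from the explicit formula for fixed `n`.
  obtain ⟨hi, he⟩ := S.integral_card_shift hF h₁ (hI.congr (.of_forall fun e => by
    dsimp only
    rw [← S.integral_sq_sum_range hgm hg]
    simp))
  refine ⟨(memLp_two_iff_integrable_sq
    (S.measurable_offspringSum hgm).aestronglyMeasurable).2 hi, he.trans ?_⟩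
  rw [← integral_mul_const, ← integral_mul_const, ← integral_add (hi₁.mul_const _)
    (hi₂.mul_const _)]
  refine integral_congr_ae (.of_forall fun e => ?_)
  exact S.integral_sq_sum_range hgm hg (N e)

lemma integrable_iterate (S : BranchingSystem μ N s σ)
    (hN : Integrable (fun e => (N e : ℝ)) μ) {g : E → ℝ} (hgm : Measurable g)
    (hg : Integrable g μ) (k : ℕ) :
    Integrable ((offspringSum N σ)^[k] g) μ ∧
      ∫ e, (offspringSum N σ)^[k] g e ∂μ = (∫ e, (N e : ℝ) ∂μ) ^ k * ∫ e, g e ∂μ := by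
  induction k with
  | zero => simpa using hg
  | succ k ih =>
    rw [Function.iterate_succ_apply']
    obtain ⟨h₁, h₂⟩ := S.integrable_offspringSum hN (S.measurable_iterate hgm k) ih.1
    refine ⟨h₁, h₂.trans ?_⟩
    rw [ih.2, pow_succ]; ring

/-- Centring kills the term carrying the second moment of `N`, so each level multiplies the second
moment by the mean offspring number, not by its square. After division by the mean size of the
level, centred sums therefore decay geometrically in $L^2$. -/
lemma memLp_iterate (S : BranchingSystem μ N s σ)
    (hN : MemLp (fun e => (N e : ℝ)) 2 μ) {g : E → ℝ} (hgm : Measurable g)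
    (hg : MemLp g 2 μ) (h₀ : ∫ e, g e ∂μ = 0) (k : ℕ) :
    MemLp ((offspringSum N σ)^[k] g) 2 μ ∧
      ∫ e, (offspringSum N σ)^[k] g e ^ 2 ∂μ =
        (∫ e, (N e : ℝ) ∂μ) ^ k * ∫ e, g e ^ 2 ∂μ := by
  induction k with
  | zero => simpa using hg
  | succ k ih =>
    have hmean : ∫ e, (offspringSum N σ)^[k] g e ∂μ = 0 := by
      rw [(S.integrable_iterate (hN.integrable (by norm_num)) hgm
        (hg.integrable (by norm_num)) k).2, h₀, mul_zero]
    rw [Function.iterate_succ_apply']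
    obtain ⟨h₁, h₂⟩ := S.memLp_offspringSum hN (S.measurable_iterate hgm k) ih.1
    refine ⟨h₁, h₂.trans ?_⟩
    rw [ih.2, hmean, pow_succ]; ring

end BranchingSystem

/-! ### Deterministic sequences -/

/-- Telescoping: by monotonicity every increment is controlled by `α n`, and the remaining factors
form a geometric series. -/
lemma sub_le_of_sub_succ_le_geometric {α : ℕ → ℝ} {K ρ : ℝ} {n₀ : ℕ} (hρ : 0 ≤ ρ) (hρ₁ : ρ < 1)
    (hK : 0 ≤ K) (hα : ∀ n, 0 ≤ α n) (hanti : Antitone α)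
    (h : ∀ n, n₀ ≤ n → α n - α (n + 1) ≤ K * ρ ^ n * α n) {n : ℕ} (hn : n₀ ≤ n) (k : ℕ) :
    α n - α (n + k) ≤ K / (1 - ρ) * ρ ^ n * α n := by
  have hgeom : α n - α (n + k) ≤ K * ρ ^ n * α n * ∑ i ∈ Finset.range k, ρ ^ i := by
    induction k with
    | zero => simp
    | succ k ih =>
      have h1 := h (n + k) (by omega)
      have h2 : K * ρ ^ (n + k) * α (n + k) ≤ K * ρ ^ (n + k) * α n :=
        mul_le_mul_of_nonneg_left (hanti (by omega)) (by positivity)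
      rw [Finset.sum_range_succ, mul_add, ← add_assoc]
      rw [pow_add] at h2 h1
      nlinarith
  refine hgeom.trans ?_
  have hsum : ∑ i ∈ Finset.range k, ρ ^ i ≤ (1 - ρ)⁻¹ := by
    rw [← tsum_geometric_of_lt_one hρ hρ₁]
    exact (summable_geometric_of_lt_one hρ hρ₁).sum_le_tsum _ fun i _ => by positivity
  calc K * ρ ^ n * α n * ∑ i ∈ Finset.range k, ρ ^ i ≤ K * ρ ^ n * α n * (1 - ρ)⁻¹ :=
        mul_le_mul_of_nonneg_left hsum (mul_nonneg (by positivity) (hα n))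
    _ = _ := by ring

lemma exists_pos_tendsto_of_sub_succ_le_geometric {α : ℕ → ℝ} {K ρ : ℝ} {n₀ : ℕ} (hρ : 0 ≤ ρ)
    (hρ₁ : ρ < 1) (hK : 0 ≤ K) (hα : ∀ n, 0 < α n) (hanti : Antitone α)
    (h : ∀ n, n₀ ≤ n → α n - α (n + 1) ≤ K * ρ ^ n * α n) :
    ∃ L, 0 < L ∧ Tendsto α atTop (𝓝 L) := by
  have hbdd : BddBelow (Set.range α) := ⟨0, by rintro _ ⟨n, rfl⟩; exact (hα n).le⟩
  refine ⟨⨅ n, α n, ?_, tendsto_atTop_ciInf hanti hbdd⟩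
  have hlim : Tendsto (fun n => K / (1 - ρ) * ρ ^ n) atTop (𝓝 0) := by
    simpa using (tendsto_pow_atTop_nhds_zero_of_lt_one hρ hρ₁).const_mul (K / (1 - ρ))
  obtain ⟨n, hn, hn'⟩ := ((hlim.eventually_lt_const (show (0 : ℝ) < 1 / 2 by norm_num)).and
    (eventually_ge_atTop n₀)).exists
  -- For this `n` the total relative loss after time `n` is below one half, so the sequence never
  -- falls under `α n / 2`.
  refine lt_of_lt_of_le (half_pos (hα n)) (le_ciInf fun j => ?_)
  have h1 := sub_le_of_sub_succ_le_geometric hρ hρ₁ hK (fun n => (hα n).le) hanti h hn' j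
  have h2 : α (n + j) ≤ α j := hanti (by omega)
  nlinarith [hα n]

/-- The coefficient $c=K/(\rho-q)$ solves $qc+K=\rho c$, so $c\rho^n$ satisfies the recursion with
equality; the homogeneous part decays at the faster rate `q`. -/
lemma le_mul_geometric_of_le_add {u : ℕ → ℝ} {q ρ K : ℝ} (hq : 0 ≤ q) (hqρ : q < ρ) (hK : 0 ≤ K)
    (hu : ∀ n, 0 ≤ u n) (h : ∀ n, u (n + 1) ≤ q * u n + K * ρ ^ n) (n : ℕ) :
    u n ≤ (u 0 + K / (ρ - q)) * ρ ^ n := by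
  have hd : 0 < ρ - q := sub_pos.2 hqρ
  induction n with
  | zero => simpa using div_nonneg hK hd.le
  | succ n ih =>
    refine (h n).trans ?_
    have hK' : K = K / (ρ - q) * (ρ - q) := by field_simp
    have h1 := mul_le_mul_of_nonneg_left ih hq
    have h2 : 0 ≤ u 0 * (ρ - q) * ρ ^ n :=
      mul_nonneg (mul_nonneg (hu 0) hd.le) (pow_nonneg (hq.trans hqρ.le) n)
    calc q * u n + K * ρ ^ n ≤ q * ((u 0 + K / (ρ - q)) * ρ ^ n) + K * ρ ^ n := by gcongr
      _ = q * ((u 0 + K / (ρ - q)) * ρ ^ n) + K / (ρ - q) * (ρ - q) * ρ ^ n := by rw [← hK']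
      _ ≤ _ := by rw [pow_succ]; nlinarith

/-! ### Conductances in series -/

/-- The conductance of an edge of resistance `s` in series with a network of conductance `A`. -/
def seriesConductance {E : Type*} (s A : E → ℝ) (e : E) : ℝ := A e / (1 + s e * A e)

section Series

variable {E : Type*} {s A : E → ℝ}

lemma seriesConductance_pos {e : E} (hs : 0 < s e) (hA : 0 < A e) :
    0 < seriesConductance s A e :=
  div_pos hA (by positivity)

lemma seriesConductance_le {e : E} (hs : 0 < s e) (hA : 0 < A e) :
    seriesConductance s A e ≤ A e :=
  div_le_self hA.le (by nlinarith [mul_pos hs hA])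

lemma seriesConductance_le_inv {e : E} (hs : 0 < s e) (hA : 0 < A e) :
    seriesConductance s A e ≤ (s e)⁻¹ := by
  rw [seriesConductance, inv_eq_one_div, div_le_div_iff₀ (by positivity) hs]
  nlinarith

/-- The difference is exactly $sA^2/(1+sA)$. -/
lemma sub_seriesConductance_le {e : E} (hs : 0 < s e) (hA : 0 < A e) :
    A e - seriesConductance s A e ≤ s e * A e ^ 2 := by
  have h : 0 < 1 + s e * A e := by positivity
  rw [seriesConductance, sub_le_iff_le_add, ← sub_le_iff_le_add', le_div_iff₀ h]
  nlinarith [mul_pos hs hA, mul_pos (mul_pos hs hA) (mul_pos hs hA),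
    mul_pos (mul_pos (mul_pos hs hA) (mul_pos hs hA)) hA]

/-- After bounding one factor of the square by $A$, it remains to compare $A(A-a)/(1+sA)$ with
$A(A-a)/(1+sa)$. Since $1/(1+sA)$ decreases in $A$, freezing its argument at `a` can only increase
the product. The last term then factors into a function of `s` and a function of `A`, and can be
made centred by the choice of `a`. -/
lemma sq_seriesConductance_le {e : E} (hs : 0 < s e) (hA : 0 < A e) {a : ℝ} (ha : 0 ≤ a) :
    seriesConductance s A e ^ 2 ≤
      a * seriesConductance s A e + (1 + s e * a)⁻¹ * (A e * (A e - a)) := by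
  have h : 0 < 1 + s e * A e := by positivity
  have h' : 0 < 1 + s e * a := by positivity
  have h1 : seriesConductance s A e ^ 2 ≤ A e * seriesConductance s A e := by
    rw [sq]
    exact mul_le_mul_of_nonneg_right (seriesConductance_le hs hA)
      (seriesConductance_pos hs hA).le
  refine h1.trans ?_
  have h2 : a * seriesConductance s A e + (1 + s e * a)⁻¹ * (A e * (A e - a)) -
      A e * seriesConductance s A e =
      A e * s e * (A e - a) ^ 2 / ((1 + s e * A e) * (1 + s e * a)) := by
    rw [seriesConductance]; field_simp; ring
  have h3 : 0 ≤ A e * s e * (A e - a) ^ 2 / ((1 + s e * A e) * (1 + s e * a)) := by positivity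
  linarith

variable [MeasurableSpace E]

lemma measurable_seriesConductance (hs : Measurable s) (hA : Measurable A) :
    Measurable (seriesConductance s A) :=
  hA.div (measurable_const.add (hs.mul hA))

variable {μ : Measure E} [IsProbabilityMeasure μ]

/-- A series connection with an independent edge does not increase the ratio of the second moment
to the first. -/
lemma integral_sq_seriesConductance_le (hsm : Measurable s) (hAm : Measurable A)
    (hind : IndepFun s A μ) (hs : ∀ᵐ e ∂μ, 0 < s e) (hA : ∀ᵐ e ∂μ, 0 < A e)
    (hA₂ : MemLp A 2 μ) (hpos : 0 < ∫ e, A e ∂μ) :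
    ∫ e, seriesConductance s A e ^ 2 ∂μ ≤
      (∫ e, A e ^ 2 ∂μ) / (∫ e, A e ∂μ) * ∫ e, seriesConductance s A e ∂μ := by
  set a := (∫ e, A e ^ 2 ∂μ) / (∫ e, A e ∂μ) with ha
  have ha₀ : 0 ≤ a := div_nonneg (integral_nonneg fun e => sq_nonneg _) hpos.le
  have hA₁ : Integrable A μ := hA₂.integrable (by norm_num)
  have hDm := measurable_seriesConductance hsm hAm
  have hD₂ : MemLp (seriesConductance s A) 2 μ := by
    refine hA₂.mono hDm.aestronglyMeasurable ?_
    filter_upwards [hs, hA] with e h1 h2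
    rw [Real.norm_of_nonneg (seriesConductance_pos h1 h2).le, Real.norm_of_nonneg h2.le]
    exact seriesConductance_le h1 h2
  have hG : Integrable (fun e => (1 + s e * a)⁻¹) μ := by
    refine Integrable.of_bound (C := 1)
      (measurable_const.add (hsm.mul_const a)).inv.aestronglyMeasurable ?_
    filter_upwards [hs] with e he
    have : 1 ≤ 1 + s e * a := by nlinarith [mul_nonneg he.le ha₀]
    rw [Real.norm_of_nonneg (by positivity)]
    exact inv_le_one_of_one_le₀ this
  have hAa : Integrable (fun e => A e * (A e - a)) μ := by
    have : (fun e => A e * (A e - a)) = fun e => A e ^ 2 - A e * a := by ext e; ring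
    rw [this]
    exact hA₂.integrable_sq.sub (hA₁.mul_const a)
  -- This equation determines `a`: it is the ratio of the second moment to the first.
  have hAa₀ : ∫ e, A e * (A e - a) ∂μ = 0 := by
    have : (fun e => A e * (A e - a)) = fun e => A e ^ 2 - A e * a := by ext e; ring
    rw [this, integral_sub hA₂.integrable_sq (hA₁.mul_const a), integral_mul_const, ha]
    field_simp
    ring
  have hind' : IndepFun (fun e => (1 + s e * a)⁻¹) (fun e => A e * (A e - a)) μ :=
    hind.comp (φ := fun x => (1 + x * a)⁻¹) (ψ := fun x => x * (x - a))
      (by fun_prop) (by fun_prop)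
  have hprod : Integrable (fun e => (1 + s e * a)⁻¹ * (A e * (A e - a))) μ :=
    hind'.integrable_mul hG hAa
  have hprod₀ : ∫ e, (1 + s e * a)⁻¹ * (A e * (A e - a)) ∂μ = 0 := by
    rw [hind'.integral_fun_mul_eq_mul_integral hG.aestronglyMeasurable
      hAa.aestronglyMeasurable, hAa₀, mul_zero]
  calc ∫ e, seriesConductance s A e ^ 2 ∂μ
      ≤ ∫ e, (a * seriesConductance s A e + (1 + s e * a)⁻¹ * (A e * (A e - a))) ∂μ := by
        refine integral_mono_ae hD₂.integrable_sq
          (((hD₂.integrable (by norm_num)).const_mul a).add hprod) ?_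
        filter_upwards [hs, hA] with e h1 h2
        exact sq_seriesConductance_le h1 h2 ha₀
    _ = _ := by
        rw [integral_add ((hD₂.integrable (by norm_num)).const_mul a) hprod, hprod₀, add_zero,
          integral_const_mul]

end Series

/-- The conductances of the first levels of a branching system, in the network in which the
resistances are multiplied by `lam` at each level: the `n`-th term is the conductance between the
root and the level `n + 1`. -/
def conductanceSeq {E : Type*} (lam : ℝ) (N : E → ℕ) (s : E → ℝ) (σ : ℕ → E → E) : ℕ → E → ℝ
  | 0 => fun e => lam⁻¹ * offspringSum N σ (fun e => (s e)⁻¹) e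
  | n + 1 => fun e =>
      lam⁻¹ * offspringSum N σ (seriesConductance s (conductanceSeq lam N s σ n)) e

/-! ### Means and second moments of the conductances. -/

namespace BranchingSystem

/-- A branching system with the moment conditions of a supercritical tree without leaves, with
positive integrable marks whose inverses are integrable. -/
structure IsSupercritical {E : Type*} [MeasurableSpace E] (μ : Measure E)
    (N : E → ℕ) (s : E → ℝ) (m : ℝ) : Prop where
  card_ne_zero : ∀ᵐ e ∂μ, N e ≠ 0
  mark_pos : ∀ᵐ e ∂μ, 0 < s e
  memLp_card : MemLp (fun e => (N e : ℝ)) 2 μ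
  integrable_mark : Integrable s μ
  integrable_inv_mark : Integrable (fun e => (s e)⁻¹) μ
  mean : ∫ e, (N e : ℝ) ∂μ = m
  one_lt : 1 < m

variable {E : Type*} [MeasurableSpace E] {μ : Measure E} {N : E → ℕ} {s : E → ℝ} {σ : ℕ → E → E}
  {lam m : ℝ}

local notation "A" => conductanceSeq lam N s σ
local notation "D" => fun n => seriesConductance s (conductanceSeq lam N s σ n)

lemma measurable_conductanceSeq (S : BranchingSystem μ N s σ) (n : ℕ) : Measurable (A n) := by
  induction n with
  | zero => exact (S.measurable_offspringSum S.measurable_mark.inv).const_mul _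
  | succ n ih =>
    exact (S.measurable_offspringSum
      (measurable_seriesConductance S.measurable_mark ih)).const_mul _

lemma measurable_series (S : BranchingSystem μ N s σ) (n : ℕ) : Measurable (D n) :=
  measurable_seriesConductance S.measurable_mark (S.measurable_conductanceSeq n)

lemma indepFun_conductanceSeq (S : BranchingSystem μ N s σ) (n : ℕ) : IndepFun s (A n) μ := by
  cases n with
  | zero =>
    exact (S.indepFun_mark_offspringSum S.measurable_mark.inv).comp measurable_id
      (measurable_const_mul lam⁻¹)
  | succ n =>
    exact (S.indepFun_mark_offspringSum (S.measurable_series n)).comp measurable_id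
      (measurable_const_mul lam⁻¹)

variable (S : BranchingSystem μ N s σ) (H : IsSupercritical μ N s m) (hlam : m < lam)

include H hlam in
lemma IsSupercritical.lam_pos : 0 < lam := by linarith [H.one_lt]

include S H hlam in
lemma conductanceSeq_pos (n : ℕ) : ∀ᵐ e ∂μ, 0 < A n e := by
  have hl := H.lam_pos hlam
  induction n with
  | zero =>
    filter_upwards [S.offspringSum_pos_ae H.card_ne_zero (g := fun e => (s e)⁻¹)
      (H.mark_pos.mono fun e he => inv_pos.2 he)] with e he
    exact mul_pos (inv_pos.2 hl) he
  | succ n ih =>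
    filter_upwards [S.offspringSum_pos_ae H.card_ne_zero (g := D n) (by
      filter_upwards [ih, H.mark_pos] with e h1 h2
      exact seriesConductance_pos h2 h1)] with e he
    exact mul_pos (inv_pos.2 hl) he

include S H hlam in
lemma series_pos (n : ℕ) : ∀ᵐ e ∂μ, 0 < D n e := by
  filter_upwards [S.conductanceSeq_pos H hlam n, H.mark_pos] with e h1 h2
  exact seriesConductance_pos h2 h1

include S H hlam in
lemma series_le (n : ℕ) : ∀ᵐ e ∂μ, D n e ≤ A n e := by
  filter_upwards [S.conductanceSeq_pos H hlam n, H.mark_pos] with e h1 h2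
  exact seriesConductance_le h2 h1

variable [IsProbabilityMeasure μ]

include S H hlam in
lemma integrable_conductanceSeq (n : ℕ) : Integrable (A n) μ ∧ Integrable (D n) μ := by
  have hD : ∀ n, Integrable (A n) μ → Integrable (D n) μ := fun n h => by
    refine h.mono (S.measurable_series n).aestronglyMeasurable ?_
    filter_upwards [S.conductanceSeq_pos H hlam n, S.series_pos H hlam n,
      S.series_le H hlam n] with e h1 h2 h3
    rwa [Real.norm_of_nonneg h1.le, Real.norm_of_nonneg h2.le]
  have hN := H.memLp_card.integrable (q := 2) (by norm_num)
  have hA : Integrable (A n) μ := by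
    induction n with
    | zero =>
      exact (S.integrable_offspringSum hN S.measurable_mark.inv H.integrable_inv_mark).1.const_mul _
    | succ n ih =>
      exact (S.integrable_offspringSum hN (S.measurable_series n) (hD n ih)).1.const_mul _
  exact ⟨hA, hD n hA⟩

include S H hlam in
lemma integral_conductanceSeq_succ (n : ℕ) :
    ∫ e, A (n + 1) e ∂μ = m / lam * ∫ e, D n e ∂μ := by
  have hN := H.memLp_card.integrable (q := 2) (by norm_num)
  have h := (S.integrable_offspringSum hN (S.measurable_series n)
    (S.integrable_conductanceSeq H hlam n).2).2
  rw [H.mean] at h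
  change ∫ e, lam⁻¹ * offspringSum N σ (D n) e ∂μ = _
  rw [integral_const_mul, h]
  ring

lemma integral_pos_of_ae_pos {f : E → ℝ} (hf : Integrable f μ) (h : ∀ᵐ e ∂μ, 0 < f e) :
    0 < ∫ e, f e ∂μ := by
  rw [integral_pos_iff_support_of_nonneg_ae (h.mono fun e he => he.le) hf]
  have : (Function.support f) =ᵐ[μ] Set.univ :=
    h.mono fun e he => eq_true (ne_of_gt he)
  rw [measure_congr this]
  simp

include S H hlam in
lemma integral_conductanceSeq_pos (n : ℕ) : 0 < ∫ e, A n e ∂μ :=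
  integral_pos_of_ae_pos (S.integrable_conductanceSeq H hlam n).1 (S.conductanceSeq_pos H hlam n)

include S H hlam in
lemma integral_series_pos (n : ℕ) : 0 < ∫ e, D n e ∂μ :=
  integral_pos_of_ae_pos (S.integrable_conductanceSeq H hlam n).2 (S.series_pos H hlam n)

include S H hlam in
lemma integral_series_le (n : ℕ) : ∫ e, D n e ∂μ ≤ ∫ e, A n e ∂μ :=
  integral_mono_ae (S.integrable_conductanceSeq H hlam n).2
    (S.integrable_conductanceSeq H hlam n).1 (S.series_le H hlam n)

include S H hlam in
lemma memLp_conductanceSeq (n : ℕ) : MemLp (D n) 2 μ ∧ MemLp (A (n + 1)) 2 μ := by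
  have hA : ∀ n, MemLp (D n) 2 μ → MemLp (A (n + 1)) 2 μ := fun n h =>
    (S.memLp_offspringSum H.memLp_card (S.measurable_series n) h).1.const_mul _
  have hD : MemLp (D n) 2 μ := by
    induction n with
    -- Only first moments of the inverse marks are assumed, so `A 0` need not be square integrable.
    -- The series edge repairs this: $D_0^2\le s^{-1}A_0$, a product of independent integrable
    -- variables.
    | zero =>
      refine (memLp_two_iff_integrable_sq (S.measurable_series 0).aestronglyMeasurable).2 ?_
      have hi : Integrable ((fun e => (s e)⁻¹) * A 0) μ :=
        ((S.indepFun_conductanceSeq 0).comp measurable_inv measurable_id).integrable_mul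
          H.integrable_inv_mark (S.integrable_conductanceSeq H hlam 0).1
      refine hi.mono ((S.measurable_series 0).pow_const 2).aestronglyMeasurable ?_
      filter_upwards [S.conductanceSeq_pos H hlam 0, H.mark_pos] with e h1 h2
      have h3 := seriesConductance_pos h2 h1
      rw [Real.norm_of_nonneg (by positivity), Pi.mul_apply, Real.norm_of_nonneg (by positivity),
        sq]
      exact mul_le_mul (seriesConductance_le_inv h2 h1) (seriesConductance_le h2 h1) h3.le
        (by positivity)
    | succ n ih =>
      refine (hA n ih).mono (S.measurable_series _).aestronglyMeasurable ?_
      filter_upwards [S.conductanceSeq_pos H hlam (n + 1), S.series_pos H hlam (n + 1),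
        S.series_le H hlam (n + 1)] with e h1 h2 h3
      rwa [Real.norm_of_nonneg h1.le, Real.norm_of_nonneg h2.le]
  exact ⟨hD, hA n hD⟩

include S H hlam in
lemma integral_sub_series_le (n : ℕ) :
    ∫ e, A (n + 1) e ∂μ - ∫ e, D (n + 1) e ∂μ ≤
      (∫ e, s e ∂μ) * ∫ e, A (n + 1) e ^ 2 ∂μ := by
  have hA₂ := (S.memLp_conductanceSeq H hlam n).2
  obtain ⟨hA, hD⟩ := S.integrable_conductanceSeq H hlam (n + 1)
  have hind : IndepFun s (fun e => A (n + 1) e ^ 2) μ :=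
    (S.indepFun_conductanceSeq (n + 1)).comp measurable_id (measurable_id.pow_const 2)
  rw [← integral_sub hA hD, ← hind.integral_fun_mul_eq_mul_integral
    H.integrable_mark.aestronglyMeasurable hA₂.integrable_sq.aestronglyMeasurable]
  refine integral_mono_ae (hA.sub hD)
    (hind.integrable_mul H.integrable_mark hA₂.integrable_sq) ?_
  filter_upwards [S.conductanceSeq_pos H hlam (n + 1), H.mark_pos] with e h1 h2
  exact sub_seriesConductance_le h2 h1

include S H hlam in
lemma integral_conductanceSeq_le (n : ℕ) :
    ∫ e, A n e ∂μ ≤ (∫ e, A 0 e ∂μ) * (m / lam) ^ n := by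
  have hl := H.lam_pos hlam
  have hm := H.one_lt
  induction n with
  | zero => simp
  | succ n ih =>
    rw [S.integral_conductanceSeq_succ H hlam, pow_succ]
    have := (S.integral_series_le H hlam n).trans ih
    calc m / lam * ∫ e, D n e ∂μ ≤ m / lam * ((∫ e, A 0 e ∂μ) * (m / lam) ^ n) := by
          gcongr
      _ = _ := by ring

include S H hlam in
-- In the second moment of a sum over the children, the variance term inherits the old ratio, as a
-- series edge does not increase it; the term in $(E[D])^2$ is at most $E[D]\,E[A]$. Dividing by
-- $(m/\lambda)E[D]$ leaves the contraction factor $\lambda^{-1}$.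
lemma ratio_succ_le (n : ℕ) :
    (∫ e, A (n + 2) e ^ 2 ∂μ) / ∫ e, A (n + 2) e ∂μ ≤
      lam⁻¹ * ((∫ e, A (n + 1) e ^ 2 ∂μ) / ∫ e, A (n + 1) e ∂μ) +
        (∫ e, (N e : ℝ) ^ 2 ∂μ) / (lam * m) * ∫ e, A (n + 1) e ∂μ := by
  have hl := H.lam_pos hlam
  have hm : 0 < m := by linarith [H.one_lt]
  have hd := S.integral_series_pos H hlam (n + 1)
  have hdc := S.integral_series_le H hlam (n + 1)
  have hM : 0 ≤ ∫ e, (N e : ℝ) ^ 2 ∂μ := integral_nonneg fun e => sq_nonneg _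
  have hq : ∫ e, A (n + 2) e ^ 2 ∂μ = (lam⁻¹) ^ 2 * (m * (∫ e, D (n + 1) e ^ 2 ∂μ -
      (∫ e, D (n + 1) e ∂μ) ^ 2) + (∫ e, (N e : ℝ) ^ 2 ∂μ) * (∫ e, D (n + 1) e ∂μ) ^ 2) := by
    rw [← H.mean, ← (S.memLp_offspringSum H.memLp_card (S.measurable_series (n + 1))
      (S.memLp_conductanceSeq H hlam (n + 1)).1).2, ← integral_const_mul]
    refine integral_congr_ae (.of_forall fun e => ?_)
    change (lam⁻¹ * offspringSum N σ (D (n + 1)) e) ^ 2 = _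
    ring
  have hb := integral_sq_seriesConductance_le S.measurable_mark
    (S.measurable_conductanceSeq (n + 1)) (S.indepFun_conductanceSeq (n + 1)) H.mark_pos
    (S.conductanceSeq_pos H hlam (n + 1)) (S.memLp_conductanceSeq H hlam n).2
    (S.integral_conductanceSeq_pos H hlam (n + 1))
  rw [hq, S.integral_conductanceSeq_succ H hlam (n + 1)]
  dsimp only at hb hd hdc ⊢
  set d := ∫ e, seriesConductance s (A (n + 1)) e ∂μ
  set d₂ := ∫ e, seriesConductance s (A (n + 1)) e ^ 2 ∂μ
  set M := ∫ e, (N e : ℝ) ^ 2 ∂μ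
  set r := (∫ e, A (n + 1) e ^ 2 ∂μ) / ∫ e, A (n + 1) e ∂μ
  rw [div_le_iff₀ (by positivity)]
  have h1 : (lam⁻¹ * r + M / (lam * m) * ∫ e, A (n + 1) e ∂μ) * (m / lam * d) =
      lam⁻¹ ^ 2 * (m * (r * d) + M * (d * ∫ e, A (n + 1) e ∂μ)) := by
    field_simp
  rw [h1]
  refine mul_le_mul_of_nonneg_left ?_ (by positivity)
  have h2 : m * (d₂ - d ^ 2) ≤ m * (r * d) :=
    mul_le_mul_of_nonneg_left (by nlinarith [sq_nonneg d]) hm.le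
  have h3 : M * d ^ 2 ≤ M * (d * ∫ e, A (n + 1) e ∂μ) :=
    mul_le_mul_of_nonneg_left (by nlinarith) hM
  linarith

include S H hlam in
/-- The second moment of the conductances is small compared with the first. -/
lemma exists_integral_sq_le : ∃ B, 0 ≤ B ∧ ∀ n, 1 ≤ n →
    ∫ e, A n e ^ 2 ∂μ ≤ B * (m / lam) ^ n * ∫ e, A n e ∂μ := by
  have hl := H.lam_pos hlam
  have hm : 0 < m := by linarith [H.one_lt]
  have hM : 0 ≤ ∫ e, (N e : ℝ) ^ 2 ∂μ := integral_nonneg fun e => sq_nonneg _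
  have hc := fun n => S.integral_conductanceSeq_pos H hlam n
  -- The ratio is taken from index `1` on, where square integrability is available; this shift
  -- explains the factor `m / lam` dividing the final constant.
  set u : ℕ → ℝ := fun n => (∫ e, A (n + 1) e ^ 2 ∂μ) / ∫ e, A (n + 1) e ∂μ with hu
  have hu₀ : ∀ n, 0 ≤ u n := fun n =>
    div_nonneg (integral_nonneg fun e => sq_nonneg _) (hc _).le
  -- Supercriticality enters here: the ratio contracts strictly faster than the means that drive it.
  have hrat : lam⁻¹ < m / lam := by
    rw [inv_eq_one_div]; exact div_lt_div_of_pos_right H.one_lt hl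
  have hK : 0 ≤ (∫ e, (N e : ℝ) ^ 2 ∂μ) / (lam * m) * ((∫ e, A 0 e ∂μ) * (m / lam)) :=
    mul_nonneg (div_nonneg hM (by positivity)) (mul_nonneg (hc 0).le (by positivity))
  have h := le_mul_geometric_of_le_add (u := u) (inv_nonneg.2 hl.le) hrat hK hu₀ fun n => by
    refine (S.ratio_succ_le H hlam n).trans (add_le_add le_rfl ?_)
    rw [mul_assoc, mul_assoc, ← pow_succ']
    exact mul_le_mul_of_nonneg_left (S.integral_conductanceSeq_le H hlam (n + 1))
      (div_nonneg hM (by positivity))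
  set B := u 0 + (∫ e, (N e : ℝ) ^ 2 ∂μ) / (lam * m) * ((∫ e, A 0 e ∂μ) * (m / lam)) /
    (m / lam - lam⁻¹)
  have hB : 0 ≤ B := add_nonneg (hu₀ 0) (div_nonneg hK (sub_pos.2 hrat).le)
  refine ⟨B / (m / lam), by positivity, fun n hn => ?_⟩
  obtain ⟨n, rfl⟩ := Nat.exists_eq_add_of_le' hn
  have h1 := h n
  rw [hu, div_le_iff₀ (hc _)] at h1
  refine h1.trans (le_of_eq ?_)
  rw [pow_succ]
  field_simp

include S H hlam in
lemma antitone_normalized_mean : Antitone fun n => (∫ e, A n e ∂μ) / (m / lam) ^ n := by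
  have hl := H.lam_pos hlam
  have hm : 0 < m := by linarith [H.one_lt]
  refine antitone_nat_of_succ_le fun n => ?_
  rw [S.integral_conductanceSeq_succ H hlam, pow_succ', mul_div_mul_left _ _ (by positivity)]
  exact div_le_div_of_nonneg_right (S.integral_series_le H hlam n) (by positivity)

include S H hlam in
lemma exists_normalized_mean_sub_succ_le : ∃ K, 0 ≤ K ∧ ∀ n, 1 ≤ n →
    (∫ e, A n e ∂μ) / (m / lam) ^ n - (∫ e, A (n + 1) e ∂μ) / (m / lam) ^ (n + 1) ≤
      K * (m / lam) ^ n * ((∫ e, A n e ∂μ) / (m / lam) ^ n) := by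
  have hl := H.lam_pos hlam
  have hm : 0 < m := by linarith [H.one_lt]
  have hs : 0 ≤ ∫ e, s e ∂μ := integral_nonneg_of_ae (H.mark_pos.mono fun e he => he.le)
  obtain ⟨B, hB, h⟩ := S.exists_integral_sq_le H hlam
  refine ⟨(∫ e, s e ∂μ) * B, by positivity, fun n hn => ?_⟩
  rw [S.integral_conductanceSeq_succ H hlam, pow_succ', mul_div_mul_left _ _ (by positivity),
    ← sub_div, ← mul_div_assoc]
  refine div_le_div_of_nonneg_right ?_ (by positivity)
  have h1 := h n hn
  obtain ⟨n, rfl⟩ := Nat.exists_eq_add_of_le' hn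
  refine (S.integral_sub_series_le H hlam n).trans ?_
  calc _ ≤ (∫ e, s e ∂μ) * _ := mul_le_mul_of_nonneg_left h1 hs
    _ = _ := by ring

include S H hlam in
/-- The normalized means of the conductances have a positive limit. -/
lemma exists_tendsto_normalized_mean : ∃ L, 0 < L ∧
    Tendsto (fun n => (∫ e, A n e ∂μ) / (m / lam) ^ n) atTop (𝓝 L) := by
  have hl := H.lam_pos hlam
  have hm : 0 < m := by linarith [H.one_lt]
  obtain ⟨K, hK, h⟩ := S.exists_normalized_mean_sub_succ_le H hlam
  exact exists_pos_tendsto_of_sub_succ_le_geometric (by positivity) ((div_lt_one hl).2 hlam) hK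
    (fun n => div_pos (S.integral_conductanceSeq_pos H hlam n) (by positivity))
    (S.antitone_normalized_mean H hlam) h

end BranchingSystem

/-! ### Almost sure convergence -/

/-- By Tonelli the sum of the series has a finite integral, hence is finite almost everywhere. -/
lemma ae_summable_of_summable_integral {E : Type*} [MeasurableSpace E] {μ : Measure E}
    {f : ℕ → E → ℝ} (hf : ∀ n, Integrable (f n) μ) (h₀ : ∀ n, ∀ᵐ e ∂μ, 0 ≤ f n e)
    (h : Summable fun n => ∫ e, f n e ∂μ) : ∀ᵐ e ∂μ, Summable fun n => f n e := by
  have hlin : ∀ n, ∫⁻ e, ENNReal.ofReal (f n e) ∂μ = ENNReal.ofReal (∫ e, f n e ∂μ) := fun n =>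
    (ofReal_integral_eq_lintegral_ofReal (hf n) (h₀ n)).symm
  have hfin : ∫⁻ e, ∑' n, ENNReal.ofReal (f n e) ∂μ ≠ ∞ := by
    rw [lintegral_tsum fun n => (hf n).aemeasurable.ennreal_ofReal]
    simp only [hlin]
    exact h.tsum_ofReal_ne_top
  have hmeas : AEMeasurable (fun e => ∑' n, ENNReal.ofReal (f n e)) μ :=
    AEMeasurable.tsum fun n => (hf n).aemeasurable.ennreal_ofReal
  filter_upwards [ae_lt_top' hmeas hfin, ae_all_iff.2 h₀] with e he h0
  have := ENNReal.summable_toReal he.ne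
  exact this.congr fun n => ENNReal.toReal_ofReal (h0 n)

lemma ae_tendsto_zero_of_summable_integral_sq {E : Type*} [MeasurableSpace E] {μ : Measure E}
    {f : ℕ → E → ℝ} (hf : ∀ n, MemLp (f n) 2 μ)
    (h : Summable fun n => ∫ e, f n e ^ 2 ∂μ) :
    ∀ᵐ e ∂μ, Tendsto (fun n => f n e) atTop (𝓝 0) := by
  filter_upwards [ae_summable_of_summable_integral (fun n => (hf n).integrable_sq)
    (fun n => .of_forall fun e => sq_nonneg _) h] with e he
  have := he.tendsto_atTop_zero.sqrt
  simp only [Real.sqrt_sq_eq_abs, Real.sqrt_zero] at this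
  exact (tendsto_zero_iff_abs_tendsto_zero _).2 this

/-- Each exponent occurs twice, once for an even index and once for an odd one. -/
lemma summable_pow_div_two {r : ℝ} (h₀ : 0 ≤ r) (h₁ : r < 1) :
    Summable fun n : ℕ => r ^ (n / 2) := by
  have h := (summable_geometric_of_lt_one h₀ h₁).hasSum
  refine (HasSum.even_add_odd (f := fun n : ℕ => r ^ (n / 2)) (m := ∑' n : ℕ, r ^ n)
    (m' := ∑' n : ℕ, r ^ n) ?_ ?_).summable
  · simpa using h
  · have : ∀ k : ℕ, (2 * k + 1) / 2 = k := fun k => by omega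
    simpa [this] using h

/-! ### Almost sure comparison of conductances with level sizes. -/

namespace BranchingSystem

variable {E : Type*} [MeasurableSpace E] {μ : Measure E} {N : E → ℕ} {s : E → ℝ} {σ : ℕ → E → E}
  {lam m : ℝ}
  (S : BranchingSystem μ N s σ) (H : IsSupercritical μ N s m) (hlam : m < lam)

local notation "A" => conductanceSeq lam N s σ
local notation "D" => fun n => seriesConductance s (conductanceSeq lam N s σ n)

include S H hlam in
/-- Keeping only the first `k` levels as perfect conductors in parallel increases the
conductance. -/
lemma conductanceSeq_add_le (n k : ℕ) : ∀ᵐ e ∂μ,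
    A (n + k) e ≤ (lam ^ k)⁻¹ * (offspringSum N σ)^[k] (A n) e := by
  have hl := H.lam_pos hlam
  induction k with
  | zero => simp
  | succ k ih =>
    have h1 : offspringSum N σ (D (n + k)) ≤ᵐ[μ]
        offspringSum N σ (fun e => (lam ^ k)⁻¹ * (offspringSum N σ)^[k] (A n) e) := by
      refine S.offspringSum_mono_ae ?_
      filter_upwards [S.series_le H hlam (n + k), ih] with e h1 h2 using h1.trans h2
    filter_upwards [h1] with e he
    rw [offspringSum_const_mul] at he
    change lam⁻¹ * offspringSum N σ (D (n + k)) e ≤ _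
    rw [Function.iterate_succ_apply', pow_succ', mul_inv, mul_assoc]
    exact mul_le_mul_of_nonneg_left he (by positivity)

variable [IsProbabilityMeasure μ]

/-- The normalized size of the `k`-th level. -/
local notation "W" => fun (k : ℕ) (e : E) =>
  (m ^ k)⁻¹ * (offspringSum N σ)^[k] (fun _ => (1 : ℝ)) e

include S H in
/-- The normalized sizes of the levels converge almost surely. -/
lemma ae_exists_tendsto_levelSize :
    ∀ᵐ e ∂μ, ∃ w, Tendsto (fun k => W k e) atTop (𝓝 w) := by
  have hm : 0 < m := by linarith [H.one_lt]
  have hN : Measurable fun e => (N e : ℝ) := measurable_from_nat.comp S.measurable_card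
  -- The constant is written as a multiple of the function `1`, whose iterated offspring sums are
  -- the level sizes; increments of `W` thus become centred level sums.
  set g : E → ℝ := fun e => (N e : ℝ) - m * 1 with hg
  have hgm : Measurable g := hN.sub_const _
  have hg₂ : MemLp g 2 μ := H.memLp_card.sub (memLp_const _)
  have hg₀ : ∫ e, g e ∂μ = 0 := by
    rw [hg, integral_sub (H.memLp_card.integrable (by norm_num)) (integrable_const _), H.mean]
    simp
  have hX := fun k => S.memLp_iterate H.memLp_card hgm hg₂ hg₀ k
  have hdiff : ∀ k e, W (k + 1) e - W k e = (m ^ (k + 1))⁻¹ * (offspringSum N σ)^[k] g e := by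
    intro k e
    rw [hg, offspringSum_iterate_sub_const_mul]
    dsimp only
    rw [Function.iterate_succ_apply, offspringSum_one, pow_succ]
    field_simp
  -- The squared increments have mean of order $m^{-k}$, so they stay summable with weights $q^{-k}$
  -- when $m^{-1}<q<1$. Then $x\le q^{-k}x^2+q^k$ makes the increments themselves absolutely
  -- summable.
  obtain ⟨q, hq₁, hq₂⟩ := exists_between (inv_lt_one_of_one_lt₀ H.one_lt)
  have hq₀ : 0 < q := (inv_pos.2 hm).trans hq₁
  have hsq : ∀ᵐ e ∂μ, Summable fun k => (q ^ k)⁻¹ * (W (k + 1) e - W k e) ^ 2 := by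
    simp only [hdiff, mul_pow]
    refine ae_summable_of_summable_integral
      (fun k => ((hX k).1.integrable_sq.const_mul _).const_mul _)
      (fun k => .of_forall fun e => by positivity) ?_
    simp only [integral_const_mul, (hX _).2, H.mean]
    have : ∀ k : ℕ, (q ^ k)⁻¹ * ((m ^ (k + 1))⁻¹ ^ 2 * (m ^ k * ∫ e, g e ^ 2 ∂μ)) =
        (m⁻¹ / q) ^ k * ((m⁻¹) ^ 2 * ∫ e, g e ^ 2 ∂μ) := fun k => by
      rw [div_pow, inv_pow m, pow_succ m]; simp only [inv_pow, mul_inv, mul_pow]; field_simp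
    simp only [this]
    exact (summable_geometric_of_lt_one (by positivity) ((div_lt_one hq₀).2 hq₁)).mul_right _
  filter_upwards [hsq] with e he
  have hsum : Summable fun k => dist (W k e) (W (k + 1) e) := by
    refine Summable.of_nonneg_of_le (fun _ => dist_nonneg) (fun k => ?_)
      (he.add (summable_geometric_of_lt_one hq₀.le hq₂))
    rw [dist_comm, Real.dist_eq]
    have hqk : 0 < q ^ k := by positivity
    set x := |W (k + 1) e - W k e|
    rw [← sq_abs (W (k + 1) e - W k e)]
    change x ≤ (q ^ k)⁻¹ * x ^ 2 + q ^ k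
    rw [← sub_nonneg]
    have : (q ^ k)⁻¹ * x ^ 2 + q ^ k - x = (q ^ k)⁻¹ * ((x - q ^ k / 2) ^ 2 + 3 / 4 * (q ^ k) ^ 2) := by
      field_simp; ring
    rw [this]; positivity
  exact cauchySeq_tendsto_of_complete (cauchySeq_of_summable_dist hsum)

include S H hlam in
/-- The normalized conductances are close to the normalized level sizes. -/
lemma ae_tendsto_sub : ∀ᵐ e ∂μ, Tendsto (fun j => A j e / (m / lam) ^ j -
    (∫ e, A (j / 2) e ∂μ) / (m / lam) ^ (j / 2) * W (j - j / 2) e) atTop (𝓝 0) := by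
  have hl := H.lam_pos hlam
  have hm : 0 < m := by linarith [H.one_lt]
  have hN := H.memLp_card.integrable (q := 2) (by norm_num)
  set ρ := m / lam with hρ
  have hρ₀ : 0 < ρ := by positivity
  have hρ₁ : ρ < 1 := (div_lt_one hl).2 hlam
  set α : ℕ → ℝ := fun n => (∫ e, A n e ∂μ) / ρ ^ n with hα
  have hα₀ : ∀ n, 0 < α n := fun n =>
    div_pos (S.integral_conductanceSeq_pos H hlam n) (by positivity)
  have hanti : Antitone α := S.antitone_normalized_mean H hlam
  -- `T n k` is the normalized conductance when the first `k` levels are shorted. It exceeds the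
  -- true one by `X n k`, and differs by `Y n k` from its value when each subtree conductance is
  -- replaced by its mean.
  set T : ℕ → ℕ → E → ℝ := fun n k e => (m ^ k)⁻¹ * (offspringSum N σ)^[k] (A n) e / ρ ^ n with hT
  set X : ℕ → ℕ → E → ℝ := fun n k e => T n k e - A (n + k) e / ρ ^ (n + k) with hX
  set Y : ℕ → ℕ → E → ℝ := fun n k e =>
    (m ^ k)⁻¹ * (offspringSum N σ)^[k] (fun e => A n e - (∫ e, A n e ∂μ) * 1) e / ρ ^ n with hY
  have hYT : ∀ n k e, Y n k e = T n k e - α n * W k e := fun n k e => by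
    simp only [hY, hT, hα]
    rw [offspringSum_iterate_sub_const_mul]
    ring
  have hXint : ∀ n k, Integrable (X n k) μ ∧ ∫ e, X n k e ∂μ = α n - α (n + k) := fun n k => by
    have hc := fun n => (S.integrable_conductanceSeq H hlam n).1
    obtain ⟨h1, h2⟩ := S.integrable_iterate hN (S.measurable_conductanceSeq n) (hc n) k
    have h3 : Integrable (T n k) μ := (h1.const_mul _).div_const _
    refine ⟨h3.sub ((hc _).div_const _), ?_⟩
    rw [hX]
    dsimp only
    rw [integral_sub h3 ((hc _).div_const _), integral_div, integral_div, integral_const_mul, h2,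
      H.mean]
    simp only [hα]
    field_simp
  have hX₀ : ∀ n k, ∀ᵐ e ∂μ, 0 ≤ X n k e := fun n k => by
    filter_upwards [S.conductanceSeq_add_le H hlam n k] with e he
    simp only [hX, hT, sub_nonneg]
    rw [div_le_div_iff₀ (by positivity) (by positivity), pow_add]
    calc A (n + k) e * ρ ^ n ≤ (lam ^ k)⁻¹ * (offspringSum N σ)^[k] (A n) e * ρ ^ n := by gcongr
      _ = _ := by rw [hρ, div_pow, div_pow]; field_simp
  have hXlim : ∀ᵐ e ∂μ, Tendsto (fun j => X (j / 2) (j - j / 2) e) atTop (𝓝 0) := by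
    obtain ⟨K, hK, hKα⟩ := S.exists_normalized_mean_sub_succ_le H hlam
    have hs : Summable fun j : ℕ => ∫ e, X (j / 2) (j - j / 2) e ∂μ := by
      have hg : Summable fun j : ℕ => K / (1 - ρ) * ρ ^ (j / 2) * α 0 :=
        ((summable_pow_div_two hρ₀.le hρ₁).mul_left _).mul_right _
      refine Summable.of_norm_bounded_eventually_nat hg ?_
      -- The geometric bound on the means starts at index `1`, hence `j / 2 ≥ 1`.
      filter_upwards [eventually_ge_atTop 2] with j hj
      rw [Real.norm_of_nonneg (integral_nonneg_of_ae (hX₀ _ _)), (hXint _ _).2]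
      refine (sub_le_of_sub_succ_le_geometric hρ₀.le hρ₁ hK (fun n => (hα₀ n).le) hanti hKα
        (show 1 ≤ j / 2 by omega) _).trans ?_
      exact mul_le_mul_of_nonneg_left (hanti (Nat.zero_le _))
        (mul_nonneg (div_nonneg hK (sub_pos.2 hρ₁).le) (by positivity))
    filter_upwards [ae_summable_of_summable_integral (fun j => (hXint _ _).1)
      (fun j => hX₀ _ _) hs] with e he using he.tendsto_atTop_zero
  -- The shift by `2` keeps the first index at least `1`, avoiding `A 0`, which may fail to be in
  -- $L^2$.
  have hYlim : ∀ᵐ e ∂μ, Tendsto (fun j => Y ((j + 2) / 2) (j + 2 - (j + 2) / 2) e)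
      atTop (𝓝 0) := by
    obtain ⟨B, hB, hBc⟩ := S.exists_integral_sq_le H hlam
    -- The centred level sum has second moment $m^k\operatorname{Var}(A_{n+1})$, with
    -- $\operatorname{Var}(A_{n+1})\le B\rho^{n+1}E[A_{n+1}]$. Normalization cancels all powers of
    -- $\rho$ and leaves $m^{-k}B\alpha_{n+1}$.
    have hYk : ∀ n k, MemLp (Y (n + 1) k) 2 μ ∧
        ∫ e, Y (n + 1) k e ^ 2 ∂μ ≤ (m⁻¹) ^ k * (B * α 0) := fun n k => by
      have hc := (S.memLp_conductanceSeq H hlam n).2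
      have hci : Integrable (A (n + 1)) μ := hc.integrable (by norm_num)
      set c := ∫ e, A (n + 1) e ∂μ with hcdef
      have hg₂ : MemLp (fun e => A (n + 1) e - c * 1) 2 μ := hc.sub (memLp_const _)
      have hg₀ : ∫ e, (A (n + 1) e - c * 1) ∂μ = 0 := by
        rw [integral_sub hci (integrable_const _)]; simp [hcdef]
      obtain ⟨h1, h2⟩ := S.memLp_iterate H.memLp_card
        ((S.measurable_conductanceSeq (n + 1)).sub_const (c * 1)) hg₂ hg₀ k
      have hYeq : Y (n + 1) k = fun e => (m ^ k)⁻¹ * (ρ ^ (n + 1))⁻¹ *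
          (offspringSum N σ)^[k] (fun e => A (n + 1) e - c * 1) e := by
        ext e; simp only [hY]; ring
      refine ⟨hYeq ▸ h1.const_mul _, ?_⟩
      simp only [hYeq, mul_pow _ _ 2, integral_const_mul, h2, H.mean]
      have hvar : ∫ e, (A (n + 1) e - c * 1) ^ 2 ∂μ ≤ B * ρ ^ (n + 1) * c := by
        have : ∫ e, (A (n + 1) e - c * 1) ^ 2 ∂μ = ∫ e, A (n + 1) e ^ 2 ∂μ - c ^ 2 := by
          have h3 : ∀ e, (A (n + 1) e - c * 1) ^ 2 =
              A (n + 1) e ^ 2 - 2 * c * A (n + 1) e + c ^ 2 := fun e => by ring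
          simp only [h3]
          rw [integral_add (f := fun e => A (n + 1) e ^ 2 - 2 * c * A (n + 1) e)
            (hc.integrable_sq.sub (hci.const_mul _)) (integrable_const _),
            integral_sub hc.integrable_sq (hci.const_mul _), integral_const_mul, ← hcdef]
          simp only [integral_const, probReal_univ, one_smul]; ring
        rw [this]
        have h4 := hBc (n + 1) (by omega)
        rw [← hcdef] at h4
        nlinarith [sq_nonneg c]
      have hα' : c = α (n + 1) * ρ ^ (n + 1) := by simp only [hα]; field_simp; rfl
      calc ((m ^ k)⁻¹ ^ 2 * (ρ ^ (n + 1))⁻¹ ^ 2) *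
            (m ^ k * ∫ e, (A (n + 1) e - c * 1) ^ 2 ∂μ)
          ≤ ((m ^ k)⁻¹ ^ 2 * (ρ ^ (n + 1))⁻¹ ^ 2) * (m ^ k * (B * ρ ^ (n + 1) * c)) := by gcongr
        _ = (m⁻¹) ^ k * (B * α (n + 1)) := by
            rw [hα', inv_pow m]; field_simp
        _ ≤ _ := by
            have := hanti (Nat.zero_le (n + 1))
            gcongr
    refine ae_tendsto_zero_of_summable_integral_sq (fun j => ?_) ?_
    · rw [show (j + 2) / 2 = j / 2 + 1 by omega]
      exact (hYk _ _).1
    · have hr : m⁻¹ < 1 := inv_lt_one_of_one_lt₀ H.one_lt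
      refine Summable.of_nonneg_of_le (fun j => integral_nonneg fun e => sq_nonneg _) (fun j => ?_)
        ((summable_pow_div_two (inv_nonneg.2 hm.le) hr).mul_right (B * α 0))
      rw [show (j + 2) / 2 = j / 2 + 1 by omega]
      refine (hYk _ _).2.trans (mul_le_mul_of_nonneg_right ?_ (mul_nonneg hB (hα₀ 0).le))
      exact pow_le_pow_of_le_one (inv_nonneg.2 hm.le) hr.le (by omega)
  filter_upwards [hXlim, hYlim] with e h1 h2
  have h3 := ((tendsto_add_atTop_iff_nat
    (f := fun j => Y (j / 2) (j - j / 2) e) 2).1 h2).sub h1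
  rw [sub_zero] at h3
  refine h3.congr fun j => ?_
  rw [hYT]
  simp only [hX]
  rw [show j / 2 + (j - j / 2) = j by omega]
  ring

include S H hlam in
/-- The conductances, divided by their means, have the same limit as the normalized sizes of the
levels. -/
lemma ae_tendsto_conductanceSeq_div_mean : ∀ᵐ e ∂μ, ∃ w,
    Tendsto (fun k => W k e) atTop (𝓝 w) ∧
      Tendsto (fun n => A n e / ∫ e, A n e ∂μ) atTop (𝓝 w) := by
  have hl := H.lam_pos hlam
  have hm : 0 < m := by linarith [H.one_lt]
  obtain ⟨L, hL, hlim⟩ := S.exists_tendsto_normalized_mean H hlam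
  filter_upwards [S.ae_exists_tendsto_levelSize H, S.ae_tendsto_sub H hlam] with e ⟨w, hw⟩ h
  refine ⟨w, hw, ?_⟩
  have hhalf : Tendsto (fun j : ℕ => j / 2) atTop atTop :=
    tendsto_atTop.2 fun b => (eventually_ge_atTop (2 * b)).mono fun j hj => by omega
  have hhalf' : Tendsto (fun j : ℕ => j - j / 2) atTop atTop :=
    tendsto_atTop.2 fun b => (eventually_ge_atTop (2 * b)).mono fun j hj => by omega
  -- Since $\alpha_{j/2}\to L$ and $W_{j-j/2}\to w$, the normalized conductance tends to $Lw$;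
  -- dividing by $\alpha_j\to L>0$ removes $L$.
  have h1 := h.add ((hlim.comp hhalf).mul (hw.comp hhalf'))
  have h2 := h1.div hlim hL.ne'
  rw [zero_add, mul_div_cancel_left₀ _ hL.ne'] at h2
  refine h2.congr fun j => ?_
  have := S.integral_conductanceSeq_pos H hlam j
  simp only [Function.comp_apply, Pi.div_apply]
  field_simp
  ring

end BranchingSystem

/-! ### The environment of a branching network -/

/-- If two families are independent, and each of them is independent of the other, then all the
variables are independent. -/
lemma iIndep_sumElim {Ω ι κ β γ : Type*} [MeasurableSpace Ω] [MeasurableSpace β]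
    [MeasurableSpace γ] {P : Measure Ω} {f : ι → Ω → β} {g : κ → Ω → γ}
    (hf : iIndepFun f P) (hg : iIndepFun g P)
    (hfg : IndepFun (fun ω x => f x ω) (fun ω x => g x ω) P) :
    iIndep (Sum.elim (fun x => MeasurableSpace.comap (f x) inferInstance)
      (fun x => MeasurableSpace.comap (g x) inferInstance)) P := by
  classical
  rw [iIndep_iff]
  intro t a ha
  have hsplit : ⋂ i ∈ t, a i =
      (⋂ x ∈ t.toLeft, a (.inl x)) ∩ ⋂ x ∈ t.toRight, a (.inr x) := by
    ext ω
    simp only [Set.mem_iInter, Set.mem_inter_iff, Finset.mem_toLeft, Finset.mem_toRight]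
    refine ⟨fun h => ⟨fun x hx => h _ hx, fun x hx => h _ hx⟩, ?_⟩
    rintro ⟨h1, h2⟩ (x | x) hx
    exacts [h1 x hx, h2 x hx]
  have hleft : MeasurableSet[MeasurableSpace.comap (fun ω x => f x ω) inferInstance]
      (⋂ x ∈ t.toLeft, a (.inl x)) := by
    refine Finset.measurableSet_biInter _ fun x hx => ?_
    obtain ⟨b, hb, hab⟩ := ha _ (Finset.mem_toLeft.1 hx)
    exact ⟨(fun u => u x) ⁻¹' b, measurable_pi_apply x hb, hab⟩
  have hright : MeasurableSet[MeasurableSpace.comap (fun ω x => g x ω) inferInstance]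
      (⋂ x ∈ t.toRight, a (.inr x)) := by
    refine Finset.measurableSet_biInter _ fun x hx => ?_
    obtain ⟨b, hb, hab⟩ := ha _ (Finset.mem_toRight.1 hx)
    exact ⟨(fun u => u x) ⁻¹' b, measurable_pi_apply x hb, hab⟩
  rw [hsplit, (Indep_iff _ _ _).1 ((IndepFun_iff_Indep _ _ _).1 hfg) _ _ hleft hright,
    ((iIndepFun_iff_iIndep _ _ _).1 hf).meas_biInter fun x hx => ha _ (Finset.mem_toLeft.1 hx),
    ((iIndepFun_iff_iIndep _ _ _).1 hg).meas_biInter fun x hx => ha _ (Finset.mem_toRight.1 hx)]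
  conv_rhs => rw [← Finset.toLeft_disjSum_toRight (u := t)]
  rw [Finset.prod_disjSum]

/-- Numbers of children and resistance factors of all the words. -/
abbrev TreeEnv : Type := (List ℕ → ℕ) × (List ℕ → ℝ)

namespace TreeEnv

/-- The number of children of the root. -/
def card (e : TreeEnv) : ℕ := e.1 []

/-- The resistance factor attached to the root. -/
def mark (e : TreeEnv) : ℝ := e.2 []

/-- The environment seen from the `i`-th child of the root. -/
def shift (i : ℕ) (e : TreeEnv) : TreeEnv := (fun x => e.1 (i :: x), fun x => e.2 (i :: x))

lemma measurable_card : Measurable card := (measurable_pi_apply _).comp measurable_fst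

lemma measurable_mark : Measurable mark := (measurable_pi_apply _).comp measurable_snd

lemma measurable_shift (i : ℕ) : Measurable (shift i) :=
  (measurable_pi_iff.2 fun _ => (measurable_pi_apply _).comp measurable_fst).prodMk
    (measurable_pi_iff.2 fun _ => (measurable_pi_apply _).comp measurable_snd)

end TreeEnv

/-! ### Law and independence structure of the environment. -/

section Network

variable {Ω : Type*} [MeasurableSpace Ω] {P : Measure Ω}
  {ν : List ℕ → Ω → ℕ} {ξ : List ℕ → Ω → ℝ}

/-- The environment of a family of random variables. -/
def treeEnv (ν : List ℕ → Ω → ℕ) (ξ : List ℕ → Ω → ℝ) (ω : Ω) : TreeEnv :=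
  (fun x => ν x ω, fun x => ξ x ω)

lemma indepFun_map {α β γ : Type*} [MeasurableSpace α] [MeasurableSpace β] [MeasurableSpace γ]
    {φ : Ω → α} {f : α → β} {g : α → γ} (hφ : Measurable φ) (hf : Measurable f)
    (hg : Measurable g) (h : IndepFun (fun ω => f (φ ω)) (fun ω => g (φ ω)) P) :
    IndepFun f g (P.map φ) := by
  rw [indepFun_iff_measure_inter_preimage_eq_mul] at h ⊢
  intro a b ha hb
  rw [Measure.map_apply hφ ((hf ha).inter (hg hb)), Measure.map_apply hφ (hf ha),
    Measure.map_apply hφ (hg hb)]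
  exact h a b ha hb

namespace IsBranchingNetwork

lemma measurable_treeEnv (h : IsBranchingNetwork P ν ξ) : Measurable (treeEnv ν ξ) :=
  (measurable_pi_iff.2 h.measurable_offspring).prodMk (measurable_pi_iff.2 h.measurable_factor)

/-- The right side does not involve `φ`: the law is the same product measure along any injection of
words. Comparing `List.cons i` with the identity gives the invariance under shifts. -/
lemma map_reindex [IsProbabilityMeasure P] (h : IsBranchingNetwork P ν ξ) {φ : List ℕ → List ℕ}
    (hφ : Function.Injective φ) :
    P.map (fun ω => ((fun x => ν (φ x) ω, fun x => ξ (φ x) ω) : TreeEnv)) =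
      (Measure.infinitePi fun _ => P.map (ν [])).prod
        (Measure.infinitePi fun _ => P.map (ξ [])) := by
  have hν : Measurable fun ω x => ν (φ x) ω := measurable_pi_iff.2 fun x => h.measurable_offspring _
  have hξ : Measurable fun ω x => ξ (φ x) ω := measurable_pi_iff.2 fun x => h.measurable_factor _
  have hind : IndepFun (fun ω x => ν (φ x) ω) (fun ω x => ξ (φ x) ω) P :=
    h.indepFun.comp (φ := fun u x => u (φ x)) (ψ := fun u x => u (φ x))
      (measurable_pi_iff.2 fun x => measurable_pi_apply _)
      (measurable_pi_iff.2 fun x => measurable_pi_apply _)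
  rw [(indepFun_iff_map_prod_eq_prod_map_map hν.aemeasurable hξ.aemeasurable).1 hind,
    (h.iIndepFun_offspring.precomp hφ).map_fun_eq_infinitePi_map
      (fun x => h.measurable_offspring (φ x)),
    (h.iIndepFun_factor.precomp hφ).map_fun_eq_infinitePi_map
      (fun x => h.measurable_factor (φ x))]
  simp only [(h.identDistrib_offspring _).map_eq, (h.identDistrib_factor _).map_eq]

lemma indepFun_of_disjoint (h : IsBranchingNetwork P ν ξ) {β γ : Type*} [MeasurableSpace β]
    [MeasurableSpace γ] {f : Ω → β} {g : Ω → γ} {T U : Set (List ℕ ⊕ List ℕ)}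
    (hTU : Disjoint T U)
    (hf : Measurable[⨆ i ∈ T, Sum.elim (fun x => MeasurableSpace.comap (ν x) inferInstance)
      (fun x => MeasurableSpace.comap (ξ x) inferInstance) i] f)
    (hg : Measurable[⨆ i ∈ U, Sum.elim (fun x => MeasurableSpace.comap (ν x) inferInstance)
      (fun x => MeasurableSpace.comap (ξ x) inferInstance) i] g) : IndepFun f g P := by
  rw [IndepFun_iff_Indep]
  refine indep_of_indep_of_le_left (indep_of_indep_of_le_right (indep_iSup_of_disjoint ?_
    (iIndep_sumElim h.iIndepFun_offspring h.iIndepFun_factor h.indepFun) hTU)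
    hg.comap_le) hf.comap_le
  rintro (x | x)
  exacts [(h.measurable_offspring x).comap_le, (h.measurable_factor x).comap_le]

omit [MeasurableSpace Ω] in
lemma measurable_offspring_iSup {T : Set (List ℕ ⊕ List ℕ)} {x : List ℕ} (hx : .inl x ∈ T) :
    Measurable[⨆ i ∈ T, Sum.elim (fun x => MeasurableSpace.comap (ν x) inferInstance)
      (fun x => MeasurableSpace.comap (ξ x) inferInstance) i] (ν x) :=
  (comap_measurable (ν x)).mono (le_iSup₂_of_le (.inl x) hx le_rfl) le_rfl

omit [MeasurableSpace Ω] in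
lemma measurable_factor_iSup {T : Set (List ℕ ⊕ List ℕ)} {x : List ℕ} (hx : .inr x ∈ T) :
    Measurable[⨆ i ∈ T, Sum.elim (fun x => MeasurableSpace.comap (ν x) inferInstance)
      (fun x => MeasurableSpace.comap (ξ x) inferInstance) i] (ξ x) :=
  (comap_measurable (ξ x)).mono (le_iSup₂_of_le (.inr x) hx le_rfl) le_rfl

omit [MeasurableSpace Ω] in
lemma measurable_shift_iSup {T : Set (List ℕ ⊕ List ℕ)} {i : ℕ}
    (hν : ∀ x, .inl (i :: x) ∈ T) (hξ : ∀ x, .inr (i :: x) ∈ T) :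
    Measurable[⨆ i ∈ T, Sum.elim (fun x => MeasurableSpace.comap (ν x) inferInstance)
      (fun x => MeasurableSpace.comap (ξ x) inferInstance) i]
      (fun ω => TreeEnv.shift i (treeEnv ν ξ ω)) :=
  Measurable.prodMk
    (@measurable_pi_iff _ _ _ (_) _ _ |>.2 fun x => measurable_offspring_iSup (hν x))
    (@measurable_pi_iff _ _ _ (_) _ _ |>.2 fun x => measurable_factor_iSup (hξ x))

/-- The environment of a branching network is a branching system. -/
lemma branchingSystem [IsProbabilityMeasure P] (h : IsBranchingNetwork P ν ξ) :
    BranchingSystem (P.map (treeEnv ν ξ)) TreeEnv.card TreeEnv.mark TreeEnv.shift where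
  measurable_card := TreeEnv.measurable_card
  measurable_mark := TreeEnv.measurable_mark
  shift i := by
    refine ⟨TreeEnv.measurable_shift i, ?_⟩
    rw [Measure.map_map (TreeEnv.measurable_shift i) h.measurable_treeEnv]
    exact (h.map_reindex (φ := fun x => i :: x) (List.cons_injective)).trans
      (h.map_reindex (φ := id) Function.injective_id).symm
  indep_shift i j hij := by
    refine indepFun_map h.measurable_treeEnv (TreeEnv.measurable_shift i)
      (TreeEnv.measurable_shift j) ?_
    refine h.indepFun_of_disjoint
      (T := {a | ∃ x, a = .inl (i :: x) ∨ a = .inr (i :: x)})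
      (U := {a | ∃ x, a = .inl (j :: x) ∨ a = .inr (j :: x)}) ?_
      (measurable_shift_iSup (fun x => ⟨x, .inl rfl⟩) fun x => ⟨x, .inr rfl⟩)
      (measurable_shift_iSup (fun x => ⟨x, .inl rfl⟩) fun x => ⟨x, .inr rfl⟩)
    rw [Set.disjoint_left]
    rintro _ ⟨x, rfl | rfl⟩ ⟨y, hy | hy⟩ <;> simp_all
  indep_card := by
    refine indepFun_map h.measurable_treeEnv TreeEnv.measurable_card
      (measurable_pi_iff.2 TreeEnv.measurable_shift) ?_
    refine h.indepFun_of_disjoint (T := {.inl []})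
      (U := {a | ∃ i x, a = .inl (i :: x) ∨ a = .inr (i :: x)}) ?_
      (measurable_offspring_iSup rfl)
      (@measurable_pi_iff _ _ _ (_) _ _ |>.2 fun i => measurable_shift_iSup
        (fun x => ⟨i, x, .inl rfl⟩) fun x => ⟨i, x, .inr rfl⟩)
    rw [Set.disjoint_left]
    rintro _ rfl ⟨i, y, hy | hy⟩ <;> simp at hy
  indep_mark := by
    refine indepFun_map h.measurable_treeEnv TreeEnv.measurable_mark
      (TreeEnv.measurable_card.prodMk (measurable_pi_iff.2 TreeEnv.measurable_shift)) ?_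
    refine h.indepFun_of_disjoint (T := {.inr []})
      (U := {a | a ≠ .inr []}) ?_
      (measurable_factor_iSup rfl)
      (Measurable.prodMk (measurable_offspring_iSup (by simp))
        (@measurable_pi_iff _ _ _ (_) _ _ |>.2 fun i => measurable_shift_iSup
          (by simp) (by simp)))
    rw [Set.disjoint_left]
    rintro _ rfl h
    exact h rfl

end IsBranchingNetwork

end Network

/-! ### Words -/

lemma nil_mem_wordTree (k : List ℕ → ℕ) : [] ∈ wordTree k := fun u i h => by
  simpa using h.length_le

lemma cons_mem_wordTree {k : List ℕ → ℕ} {i : ℕ} {x : List ℕ} :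
    i :: x ∈ wordTree k ↔ i < k [] ∧ x ∈ wordTree fun y => k (i :: y) := by
  constructor
  · refine fun h => ⟨h [] i (by simp), fun u j hu => h (i :: u) j ?_⟩
    simpa using hu
  · rintro ⟨hi, hx⟩ (_ | ⟨j, u⟩) l hu
    · obtain rfl : l = i := by simpa using hu
      exact hi
    · obtain ⟨rfl, hu'⟩ := List.cons_prefix_cons.1 hu
      exact hx u l hu'

lemma append_singleton_mem_wordTree {k : List ℕ → ℕ} {i : ℕ} {x : List ℕ} :
    x ++ [i] ∈ wordTree k ↔ x ∈ wordTree k ∧ i < k x := by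
  constructor
  · exact fun h => ⟨fun u j hu => h u j (hu.trans (List.prefix_append _ _)), h x i List.prefix_rfl⟩
  · rintro ⟨hx, hi⟩ u j hu
    rcases List.prefix_concat_iff.1 hu with h | h
    · obtain ⟨rfl, h⟩ := List.append_inj' h rfl
      obtain rfl : j = i := by simpa using h
      exact hi
    · exact hx u j h

/-- The `n`-th level of the tree, as a finite set. -/
def levelFinset : ℕ → (List ℕ → ℕ) → Finset (List ℕ)
  | 0, _ => {[]}
  | n + 1, k => (Finset.range (k [])).biUnion fun i =>
      (levelFinset n fun x => k (i :: x)).map ⟨List.cons i, List.cons_injective⟩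

lemma coe_levelFinset (n : ℕ) (k : List ℕ → ℕ) : (levelFinset n k : Set (List ℕ)) = treeLevel k n := by
  induction n generalizing k with
  | zero =>
    ext x
    simp only [levelFinset, Finset.coe_singleton, Set.mem_singleton_iff, treeLevel,
      Set.mem_ofPred_eq, List.length_eq_zero_iff]
    exact ⟨fun h => ⟨h ▸ nil_mem_wordTree k, h⟩, fun h => h.2⟩
  | succ n ih =>
    ext x
    have h : ∀ i y, y ∈ levelFinset n (fun x => k (i :: x)) ↔
        y ∈ wordTree (fun x => k (i :: x)) ∧ y.length = n := fun i y => by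
      rw [← Finset.mem_coe, ih]; rfl
    rcases x with _ | ⟨i, x⟩
    · simp [levelFinset, treeLevel]
    · simp only [levelFinset, treeLevel, cons_mem_wordTree, Finset.mem_coe, Finset.mem_biUnion,
        Finset.mem_range, Finset.mem_map, Function.Embedding.coeFn_mk, List.cons.injEq, h,
        Set.mem_ofPred_eq, List.length_cons, add_left_inj]
      aesop

lemma sum_levelFinset_succ {M : Type*} [AddCommMonoid M] (n : ℕ) (k : List ℕ → ℕ)
    (f : List ℕ → M) : ∑ x ∈ levelFinset (n + 1) k, f x =
      ∑ i ∈ Finset.range (k []), ∑ x ∈ levelFinset n (fun x => k (i :: x)), f (i :: x) := by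
  rw [levelFinset, Finset.sum_biUnion]
  · simp
  · intro i _ j _ hij
    rw [Function.onFun, Finset.disjoint_left]
    simp only [Finset.mem_map, Function.Embedding.coeFn_mk, not_exists, not_and]
    rintro _ ⟨x, _, rfl⟩ y _ h
    exact hij (by simpa using (congrArg List.head? h).symm)

/-- Splitting words by their first letter is splitting a tree into its root and the subtrees of the
children. -/
lemma tsum_list (f : List ℕ → ℝ≥0∞) : ∑' x, f x = f [] + ∑' i, ∑' x, f (i :: x) := by
  let φ : Unit ⊕ (ℕ × List ℕ) ≃ List ℕ :=
    { toFun := Sum.elim (fun _ => []) fun p => p.1 :: p.2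
      invFun := fun x => match x with
        | [] => .inl ()
        | i :: x => .inr (i, x)
      left_inv := by rintro (_ | _) <;> rfl
      right_inv := by rintro (_ | _) <;> rfl }
  rw [← φ.tsum_eq f, ENNReal.summable.tsum_sum ENNReal.summable]
  · simp [φ, ENNReal.tsum_prod (f := fun i x => f (i :: x))]

namespace TreeEnv

/-! ### Energies -/

/-- The energy of the edge above the word `x` when the flow through the edges is `h`. -/
def wordEnergy (lam : ℝ) (e : TreeEnv) (h : List ℕ → ℝ) (x : List ℕ) : ℝ≥0∞ :=
  open Classical in
  if x ≠ [] ∧ x ∈ wordTree e.1 then ENNReal.ofReal (lam ^ x.length * e.2 x * h x ^ 2) else 0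

lemma wordEnergy_cons {lam : ℝ} (hl : 0 ≤ lam) {e : TreeEnv} (h : List ℕ → ℝ) {i : ℕ}
    (hi : i < e.card) (x : List ℕ) :
    wordEnergy lam e h (i :: x) =
      (if x = [] then ENNReal.ofReal (lam * (shift i e).mark * h [i] ^ 2) else 0) +
        ENNReal.ofReal lam * wordEnergy lam (shift i e) (fun y => h (i :: y)) x := by
  have hi' : i < e.1 [] := hi
  rcases eq_or_ne x [] with rfl | hx
  · simp [wordEnergy, cons_mem_wordTree, nil_mem_wordTree, hi', shift, mark]
  · by_cases hw : x ∈ wordTree fun y => e.1 (i :: y)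
    · simp only [wordEnergy, cons_mem_wordTree, hx, hw, hi', shift, if_false, zero_add, ne_eq,
        reduceCtorEq, not_false_eq_true, and_self, if_true, List.length_cons]
      rw [← ENNReal.ofReal_mul hl]
      congr 1; ring
    · simp [wordEnergy, cons_mem_wordTree, hx, hw, shift]

lemma wordEnergy_cons_of_le {lam : ℝ} {e : TreeEnv} (h : List ℕ → ℝ) {i : ℕ}
    (hi : e.card ≤ i) (x : List ℕ) : wordEnergy lam e h (i :: x) = 0 := by
  have hi' : ¬ i < e.1 [] := not_lt.2 hi
  simp [wordEnergy, cons_mem_wordTree, hi']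

/-- The energy of a flow on the tree decomposes over the subtrees of the children of the root. -/
lemma tsum_wordEnergy {lam : ℝ} (hl : 0 ≤ lam) (e : TreeEnv) (h : List ℕ → ℝ) :
    ∑' x, wordEnergy lam e h x = ∑ i ∈ Finset.range e.card, ENNReal.ofReal lam *
      (ENNReal.ofReal ((shift i e).mark * h [i] ^ 2) +
        ∑' x, wordEnergy lam (shift i e) (fun y => h (i :: y)) x) := by
  rw [tsum_list, tsum_eq_sum (s := Finset.range e.card)]
  · rw [show wordEnergy lam e h [] = 0 by simp [wordEnergy], zero_add]
    refine Finset.sum_congr rfl fun i hi => ?_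
    simp only [wordEnergy_cons hl h (Finset.mem_range.1 hi)]
    rw [ENNReal.tsum_add, ENNReal.tsum_mul_left, tsum_ite_eq, mul_add, ← ENNReal.ofReal_mul hl,
      mul_assoc]
  · intro i hi
    simp [wordEnergy_cons_of_le h (not_lt.1 (by simpa using hi))]

lemma tsum_wordEnergy_const_mul {lam : ℝ} (e : TreeEnv) (c : ℝ) (h : List ℕ → ℝ) :
    ∑' x, wordEnergy lam e (fun y => c * h y) x =
      ENNReal.ofReal (c ^ 2) * ∑' x, wordEnergy lam e h x := by
  rw [← ENNReal.tsum_mul_left]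
  refine tsum_congr fun x => ?_
  rw [wordEnergy, wordEnergy]
  split_ifs
  · rw [← ENNReal.ofReal_mul (sq_nonneg c)]; congr 1; ring
  · simp

/-- The resistance factors are positive and the tree has no leaf. -/
def Regular (e : TreeEnv) : Prop := ∀ x, 0 < e.2 x ∧ e.1 x ≠ 0

lemma Regular.shift {e : TreeEnv} (h : e.Regular) (i : ℕ) : (shift i e).Regular :=
  fun x => h (i :: x)

lemma Regular.mark_pos {e : TreeEnv} (h : e.Regular) : 0 < e.mark := (h []).1

/-- The conductance from the parent of the root to the `n`-th level. -/
def branch (lam : ℝ) : ℕ → TreeEnv → ℝ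
  | 0 => fun e => e.mark⁻¹
  | n + 1 => seriesConductance mark (conductanceSeq lam card mark TreeEnv.shift n)

lemma conductanceSeq_eq_branch (lam : ℝ) (n : ℕ) (e : TreeEnv) :
    conductanceSeq lam card mark shift n e =
      lam⁻¹ * ∑ i ∈ Finset.range e.card, branch lam n (shift i e) := by
  cases n <;> rfl

variable {lam : ℝ}

lemma branch_pos (hl : 0 < lam) (n : ℕ) {e : TreeEnv} (he : e.Regular) : 0 < branch lam n e := by
  induction n generalizing e with
  | zero => exact inv_pos.2 he.mark_pos
  | succ n ih =>
    refine seriesConductance_pos he.mark_pos ?_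
    rw [conductanceSeq_eq_branch]
    exact mul_pos (inv_pos.2 hl) (Finset.sum_pos (fun i _ => ih (he.shift i))
      (by simpa [card] using (he []).2))

lemma conductanceSeq_pos (hl : 0 < lam) (n : ℕ) {e : TreeEnv} (he : e.Regular) :
    0 < conductanceSeq lam card mark shift n e := by
  rw [conductanceSeq_eq_branch]
  exact mul_pos (inv_pos.2 hl) (Finset.sum_pos (fun i _ => branch_pos hl n (he.shift i))
    (by simpa [card] using (he []).2))

lemma inv_branch_succ (hl : 0 < lam) (n : ℕ) {e : TreeEnv} (he : e.Regular) :
    (branch lam (n + 1) e)⁻¹ = e.mark + (conductanceSeq lam card mark shift n e)⁻¹ := by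
  have := conductanceSeq_pos hl n he
  rw [branch, seriesConductance, inv_div]
  field_simp
  ring

/-- The node law at the vertices of depth less than `n`, for the flow `h` through the edges. -/
def NodeLaw (n : ℕ) (e : TreeEnv) (h : List ℕ → ℝ) : Prop :=
  ∀ x ∈ wordTree e.1, x.length < n → h x = ∑ i ∈ Finset.range (e.1 x), h (x ++ [i])

lemma NodeLaw.shift {n : ℕ} {e : TreeEnv} {h : List ℕ → ℝ} (H : NodeLaw (n + 1) e h) {i : ℕ}
    (hi : i < e.card) : NodeLaw n (shift i e) fun x => h (i :: x) := fun x hx hn =>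
  H (i :: x) (cons_mem_wordTree.2 ⟨hi, hx⟩) (by simpa using hn)

/-- The parallel law: with the node law at the root, Cauchy–Schwarz in the form $(\sum h_i)^2/\sum
B_i\le\sum h_i^2/B_i$ combines the bounds of the branches. These are a hypothesis, so that the step
serves both the induction on branches and the final bound. -/
lemma le_tsum_wordEnergy (hl : 0 < lam) (n : ℕ) {e : TreeEnv} (he : e.Regular)
    {h : List ℕ → ℝ} (H : NodeLaw (n + 1) e h)
    (ih : ∀ i < e.card, ENNReal.ofReal (h [i] ^ 2 * (branch lam n (shift i e))⁻¹) ≤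
      ENNReal.ofReal ((shift i e).mark * h [i] ^ 2) +
        ∑' x, wordEnergy lam (shift i e) (fun y => h (i :: y)) x) :
    ENNReal.ofReal (h [] ^ 2 * (conductanceSeq lam card mark shift n e)⁻¹) ≤
      ∑' x, wordEnergy lam e h x := by
  have hB : ∀ i, 0 < branch lam n (shift i e) := fun i => branch_pos hl n (he.shift i)
  rw [tsum_wordEnergy hl.le]
  calc ENNReal.ofReal (h [] ^ 2 * (conductanceSeq lam card mark shift n e)⁻¹)
      ≤ ENNReal.ofReal (∑ i ∈ Finset.range e.card,
          lam * (h [i] ^ 2 * (branch lam n (shift i e))⁻¹)) := by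
        refine ENNReal.ofReal_le_ofReal ?_
        rw [H [] (nil_mem_wordTree _) (by simp), conductanceSeq_eq_branch, mul_inv, inv_inv,
          ← Finset.mul_sum, mul_left_comm]
        refine mul_le_mul_of_nonneg_left ?_ hl.le
        have := Finset.sq_sum_div_le_sum_sq_div (Finset.range e.card) (fun i => h [i])
          (g := fun i => branch lam n (shift i e)) fun i _ => hB i
        simpa [div_eq_mul_inv, card] using this
    _ = ∑ i ∈ Finset.range e.card, ENNReal.ofReal lam *
          ENNReal.ofReal (h [i] ^ 2 * (branch lam n (shift i e))⁻¹) := by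
        rw [ENNReal.ofReal_sum_of_nonneg fun i _ => by have := hB i; positivity]
        exact Finset.sum_congr rfl fun i _ => ENNReal.ofReal_mul hl.le
    _ ≤ _ := Finset.sum_le_sum fun i hi => by
        gcongr
        exact ih i (Finset.mem_range.1 hi)

/-- Including the edge above the root closes the induction: resistances in series add, and the
parallel law handles what lies below. -/
lemma branch_energy_le (hl : 0 < lam) (n : ℕ) {e : TreeEnv} (he : e.Regular)
    {h : List ℕ → ℝ} (H : NodeLaw n e h) :
    ENNReal.ofReal (h [] ^ 2 * (branch lam n e)⁻¹) ≤
      ENNReal.ofReal (e.mark * h [] ^ 2) + ∑' x, wordEnergy lam e h x := by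
  induction n generalizing e h with
  | zero => simp [branch, mul_comm]
  | succ n ih =>
    have := conductanceSeq_pos hl n he
    have := he.mark_pos
    rw [inv_branch_succ hl n he, mul_add, ENNReal.ofReal_add (by positivity) (by positivity),
      mul_comm (h [] ^ 2) e.mark]
    gcongr
    exact le_tsum_wordEnergy hl n he H fun i hi => ih (he.shift i) (H.shift hi)

/-- Thomson's principle on a tree, lower bound: a flow of strength `h []` from the root that
satisfies the node law up to level `n` has at least the energy of the current. -/
lemma conductanceSeq_energy_le (hl : 0 < lam) (n : ℕ) {e : TreeEnv} (he : e.Regular)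
    {h : List ℕ → ℝ} (H : NodeLaw (n + 1) e h) :
    ENNReal.ofReal (h [] ^ 2 * (conductanceSeq lam card mark shift n e)⁻¹) ≤
      ∑' x, wordEnergy lam e h x :=
  le_tsum_wordEnergy hl n he H fun i hi => branch_energy_le hl n (he.shift i) (H.shift hi)

/-- The unit current from the root to the `n`-th level, through the edge above a word. -/
def unitCurrent (lam : ℝ) : ℕ → TreeEnv → List ℕ → ℝ
  | _, _, [] => 1
  | 0, _, _ :: _ => 0
  | n + 1, e, i :: x =>
      (if i < e.card then
        branch lam n (shift i e) / (lam * conductanceSeq lam card mark shift n e) else 0) *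
          unitCurrent lam n (shift i e) x

lemma unitCurrent_nil (n : ℕ) (e : TreeEnv) : unitCurrent lam n e [] = 1 := by
  cases n <;> rfl

lemma unitCurrent_of_lt {n : ℕ} {e : TreeEnv} {x : List ℕ} (h : n < x.length) :
    unitCurrent lam n e x = 0 := by
  induction n generalizing e x with
  | zero => rcases x with _ | _ <;> simp_all [unitCurrent]
  | succ n ih =>
    rcases x with _ | ⟨i, x⟩
    · simp at h
    · rw [unitCurrent, ih (by simpa using h), mul_zero]

/-- The current splits among the children in proportion to their branch conductances; this is the
normalizing total. -/
lemma sum_branch (hl : 0 < lam) (n : ℕ) (e : TreeEnv) :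
    ∑ i ∈ Finset.range e.card, branch lam n (shift i e) =
      lam * conductanceSeq lam card mark shift n e := by
  rw [conductanceSeq_eq_branch]; field_simp

lemma unitCurrent_nodeLaw (hl : 0 < lam) (n : ℕ) {e : TreeEnv} (he : e.Regular) :
    NodeLaw n e (unitCurrent lam n e) := by
  intro x hx hn
  induction x generalizing n e with
  | nil =>
    obtain ⟨n, rfl⟩ : ∃ k, n = k + 1 := Nat.exists_eq_add_of_le' hn
    have hA := conductanceSeq_pos hl n he
    have : ∀ i ∈ Finset.range (e.1 []), unitCurrent lam (n + 1) e ([] ++ [i]) =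
        branch lam n (shift i e) / (lam * conductanceSeq lam card mark shift n e) := fun i hi => by
      have hi' : i < e.card := Finset.mem_range.1 hi
      simp [unitCurrent, unitCurrent_nil, hi']
    rw [Finset.sum_congr rfl this, ← Finset.sum_div]
    change _ = (∑ i ∈ Finset.range e.card, _) / _
    rw [sum_branch hl, unitCurrent_nil, div_self (by positivity)]
  | cons i x ih =>
    obtain ⟨n, rfl⟩ := Nat.exists_eq_add_of_le' (Nat.one_le_of_lt hn)
    obtain ⟨hi, hx⟩ := cons_mem_wordTree.1 hx
    have := ih n (he.shift i) hx (by simpa using hn)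
    simp only [List.cons_append, unitCurrent]
    rw [← Finset.mul_sum, this]
    rfl

lemma sum_level_unitCurrent (hl : 0 < lam) (n : ℕ) {e : TreeEnv} (he : e.Regular) :
    ∑ x ∈ levelFinset n e.1, unitCurrent lam n e x = 1 := by
  induction n generalizing e with
  | zero => simp [levelFinset, unitCurrent]
  | succ n ih =>
    have hA := conductanceSeq_pos hl n he
    rw [sum_levelFinset_succ]
    have : ∀ i ∈ Finset.range (e.1 []), ∑ x ∈ levelFinset n (fun x => e.1 (i :: x)),
        unitCurrent lam (n + 1) e (i :: x) =
        branch lam n (shift i e) / (lam * conductanceSeq lam card mark shift n e) := fun i hi => by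
      have hi' : i < e.card := Finset.mem_range.1 hi
      simp only [unitCurrent, hi', if_true]
      rw [← Finset.mul_sum]
      exact (congrArg _ (ih (he.shift i))).trans (mul_one _)
    rw [Finset.sum_congr rfl this, ← Finset.sum_div]
    change (∑ i ∈ Finset.range e.card, _) / _ = _
    rw [sum_branch hl, div_self (by positivity)]

/-- The energy of the unit current. -/
lemma tsum_wordEnergy_unitCurrent_succ (hl : 0 < lam) (n : ℕ) {e : TreeEnv} (he : e.Regular)
    (ih : ∀ i, ENNReal.ofReal (shift i e).mark +
      ∑' x, wordEnergy lam (shift i e) (unitCurrent lam n (shift i e)) x =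
        ENNReal.ofReal (branch lam n (shift i e))⁻¹) :
    ∑' x, wordEnergy lam e (unitCurrent lam (n + 1) e) x =
      ENNReal.ofReal (conductanceSeq lam card mark shift n e)⁻¹ := by
  have hA := conductanceSeq_pos hl n he
  have hB : ∀ i, 0 < branch lam n (shift i e) := fun i => branch_pos hl n (he.shift i)
  set a := conductanceSeq lam card mark shift n e with ha
  -- A branch of conductance $B_i$ carries the fraction $B_i/(\lambda a)$, so its energy is
  -- $\lambda(B_i/(\lambda a))^2/B_i=B_i/(\lambda a^2)$; the sum over the children is $1/a$.
  have hterm : ∀ i ∈ Finset.range e.card, ENNReal.ofReal lam *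
      (ENNReal.ofReal ((shift i e).mark * unitCurrent lam (n + 1) e [i] ^ 2) +
        ∑' x, wordEnergy lam (shift i e) (fun y => unitCurrent lam (n + 1) e (i :: y)) x) =
      ENNReal.ofReal (branch lam n (shift i e) * (lam * a ^ 2)⁻¹) := fun i hi => by
    have hi' : i < e.card := Finset.mem_range.1 hi
    simp only [unitCurrent, hi', if_true, unitCurrent_nil, mul_one]
    rw [tsum_wordEnergy_const_mul, mul_comm (shift i e).mark, ENNReal.ofReal_mul (sq_nonneg _),
      ← mul_add, ih, ← ENNReal.ofReal_mul (sq_nonneg _), ← ENNReal.ofReal_mul hl.le]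
    congr 1
    have := hB i
    rw [← ha]
    field_simp
  rw [tsum_wordEnergy hl.le, Finset.sum_congr rfl hterm,
    ← ENNReal.ofReal_sum_of_nonneg fun i _ => by have := hB i; positivity, ← Finset.sum_mul,
    sum_branch hl, ← ha]
  congr 1
  field_simp

lemma mark_add_tsum_wordEnergy_unitCurrent (hl : 0 < lam) (n : ℕ) {e : TreeEnv}
    (he : e.Regular) :
    ENNReal.ofReal e.mark + ∑' x, wordEnergy lam e (unitCurrent lam n e) x =
      ENNReal.ofReal (branch lam n e)⁻¹ := by
  induction n generalizing e with
  | zero =>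
    have : ∀ x, wordEnergy lam e (unitCurrent lam 0 e) x = 0 := fun x => by
      rcases x with _ | _ <;> simp [wordEnergy, unitCurrent]
    simp [this, branch]
  | succ n ih =>
    have := conductanceSeq_pos hl n he
    rw [tsum_wordEnergy_unitCurrent_succ hl n he fun i => ih (he.shift i),
      inv_branch_succ hl n he, ENNReal.ofReal_add he.mark_pos.le (by positivity)]

lemma tsum_wordEnergy_unitCurrent (hl : 0 < lam) (n : ℕ) {e : TreeEnv} (he : e.Regular) :
    ∑' x, wordEnergy lam e (unitCurrent lam (n + 1) e) x =
      ENNReal.ofReal (conductanceSeq lam card mark shift n e)⁻¹ :=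
  tsum_wordEnergy_unitCurrent_succ hl n he fun i =>
    mark_add_tsum_wordEnergy_unitCurrent hl n (he.shift i)

end TreeEnv

/-! ### Flows on the tree -/

lemma treeGraph_adj_append {k : List ℕ → ℕ} {x : List ℕ} {i : ℕ} (hx : x ++ [i] ∈ wordTree k) :
    (treeGraph k).Adj x (x ++ [i]) :=
  ⟨(append_singleton_mem_wordTree.1 hx).1, hx, .inl ⟨i, rfl⟩⟩

lemma finsum_treeGraph_adj_nil (k : List ℕ → ℕ) (f : List ℕ → ℝ) :
    ∑ᶠ (y) (_ : (treeGraph k).Adj [] y), f y = ∑ i ∈ Finset.range (k []), f [i] := by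
  have h : {y | (treeGraph k).Adj [] y} =
      ((Finset.range (k [])).map ⟨fun i => [i], List.singleton_injective⟩ : Finset (List ℕ)) := by
    ext y
    simp only [Set.mem_ofPred_eq, Finset.coe_map, Function.Embedding.coeFn_mk, Finset.coe_range,
      Set.mem_image, Set.mem_Iio]
    constructor
    · rintro ⟨-, h, ⟨i, rfl⟩ | ⟨i, hi⟩⟩
      · exact ⟨i, (append_singleton_mem_wordTree.1 h).2, rfl⟩
      · simp at hi
    · rintro ⟨i, hi, rfl⟩
      exact treeGraph_adj_append (x := [])
        (append_singleton_mem_wordTree.2 ⟨nil_mem_wordTree k, hi⟩)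
  change ∑ᶠ y ∈ {y | (treeGraph k).Adj [] y}, f y = _
  rw [h, finsum_mem_coe_finset, Finset.sum_map]
  rfl

lemma finsum_treeGraph_adj_append {k : List ℕ → ℕ} {p : List ℕ} {j : ℕ}
    (hx : p ++ [j] ∈ wordTree k) (f : List ℕ → ℝ) :
    ∑ᶠ (y) (_ : (treeGraph k).Adj (p ++ [j]) y), f y =
      f p + ∑ i ∈ Finset.range (k (p ++ [j])), f (p ++ [j] ++ [i]) := by
  have hinj : Function.Injective fun i => p ++ [j] ++ [i] := fun a b h => by simpa using h
  have hp : p ∉ (Finset.range (k (p ++ [j]))).map ⟨fun i => p ++ [j] ++ [i], hinj⟩ := by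
    simp only [Finset.mem_map, not_exists, not_and]
    intro i _ h
    have := congrArg List.length h
    simp at this
  have h : {y | (treeGraph k).Adj (p ++ [j]) y} =
      (Finset.cons p ((Finset.range (k (p ++ [j]))).map
        ⟨fun i => p ++ [j] ++ [i], hinj⟩) hp : Finset (List ℕ)) := by
    ext y
    simp only [Set.mem_ofPred_eq, Finset.coe_cons, Finset.coe_map, Function.Embedding.coeFn_mk,
      Finset.coe_range, Set.mem_insert_iff, Set.mem_image, Set.mem_Iio]
    constructor
    · rintro ⟨-, h, ⟨i, rfl⟩ | ⟨i, hi⟩⟩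
      · exact .inr ⟨i, (append_singleton_mem_wordTree.1 h).2, rfl⟩
      · exact .inl (List.append_inj' hi rfl).1.symm
    · rintro (rfl | ⟨i, hi, rfl⟩)
      · exact (treeGraph_adj_append hx).symm
      · exact treeGraph_adj_append (append_singleton_mem_wordTree.2 ⟨hx, hi⟩)
  change ∑ᶠ y ∈ {y | (treeGraph k).Adj (p ++ [j]) y}, f y = _
  rw [h, finsum_mem_coe_finset, Finset.sum_cons, Finset.sum_map]
  rfl

lemma treeGraph_adj_length {k : List ℕ → ℕ} {x y : List ℕ} (h : (treeGraph k).Adj x y) :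
    x.length ≠ y.length := by
  rcases h.2.2 with ⟨i, rfl⟩ | ⟨i, rfl⟩ <;> simp

/-- The flow through the edge above a word, which is `1` for the root. -/
def NetworkFlow.above {k : List ℕ → ℕ} (θ : NetworkFlow (treeGraph k)) (x : List ℕ) : ℝ :=
  if x = [] then 1 else θ.toFun x.dropLast x

lemma NetworkFlow.above_append {k : List ℕ → ℕ} (θ : NetworkFlow (treeGraph k)) (x : List ℕ)
    (i : ℕ) : θ.above (x ++ [i]) = θ.toFun x (x ++ [i]) := by
  simp [NetworkFlow.above]

lemma treeGraph_adj_dropLast {k : List ℕ → ℕ} {x : List ℕ} (h : x ≠ []) (hx : x ∈ wordTree k) :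
    (treeGraph k).Adj x.dropLast x := by
  have h' := List.dropLast_concat_getLast h
  rw [← h'] at hx
  simpa [h'] using treeGraph_adj_append hx

/-- The edges of the tree correspond to the vertices other than the root. -/
lemma bijective_edge_above (k : List ℕ → ℕ) : Function.Bijective
    fun x : {x : List ℕ | x ≠ [] ∧ x ∈ wordTree k} =>
      (⟨s(x.1.dropLast, x.1), treeGraph_adj_dropLast x.2.1 x.2.2⟩ : (treeGraph k).edgeSet) := by
  constructor
  · rintro ⟨x, hx, hx'⟩ ⟨y, hy, hy'⟩ h
    have h1 := congrArg Subtype.val h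
    dsimp only at h1
    rw [Sym2.eq_iff] at h1
    rcases h1 with ⟨-, h1⟩ | ⟨h1, h2⟩
    · exact Subtype.ext h1
    · exfalso
      have h3 := congrArg List.length h1
      have h4 := congrArg List.length h2
      have := List.length_pos_iff.2 hx
      simp only [List.length_dropLast] at h3 h4
      omega
  · rintro ⟨e, he⟩
    induction e with
    | _ x y =>
      obtain ⟨hx, hy, ⟨i, hi⟩ | ⟨i, hi⟩⟩ := he
      · obtain rfl : y = x ++ [i] := hi
        exact ⟨⟨x ++ [i], by simp, hy⟩, Subtype.ext (by simp)⟩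
      · obtain rfl : x = y ++ [i] := hi
        exact ⟨⟨y ++ [i], by simp, hx⟩, Subtype.ext (by simp [Sym2.eq_swap])⟩

lemma NetworkFlow.energy_eq_tsum {e : TreeEnv} (θ : NetworkFlow (treeGraph e.1)) (lam : ℝ) :
    θ.energy (edgeResistance lam e.2) = ∑' x, TreeEnv.wordEnergy lam e θ.above x := by
  classical
  rw [NetworkFlow.energy, ← (Equiv.ofBijective _ (bijective_edge_above e.1)).tsum_eq]
  have h : ∀ x : {x : List ℕ | x ≠ [] ∧ x ∈ wordTree e.1},
      ENNReal.ofReal (edgeResistance lam e.2 s(x.1.dropLast, x.1) *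
        θ.edgeSq s(x.1.dropLast, x.1)) =
      ENNReal.ofReal (lam ^ x.1.length * e.2 x.1 * θ.above x.1 ^ 2) := fun x => by
    have := List.length_pos_iff.2 x.2.1
    simp [edgeResistance, NetworkFlow.edgeSq, NetworkFlow.above, this, x.2.1]
  refine (tsum_congr h).trans ?_
  rw [tsum_subtype {x : List ℕ | x ≠ [] ∧ x ∈ wordTree e.1}
    fun x => ENNReal.ofReal (lam ^ x.length * e.2 x * θ.above x ^ 2)]
  refine tsum_congr fun x => ?_
  rw [TreeEnv.wordEnergy, Set.indicator_apply]
  congr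

/-- The convention that `above` equals `1` at the root turns the unit outflow condition into the
node law there. -/
lemma NetworkFlow.IsUnitFlow.nodeLaw {e : TreeEnv} {θ : NetworkFlow (treeGraph e.1)} {n : ℕ}
    (h : θ.IsUnitFlow {[]} (treeLevel e.1 n)) : TreeEnv.NodeLaw n e θ.above := by
  intro x hx hn
  simp only [θ.above_append]
  rcases List.eq_nil_or_concat x with rfl | ⟨p, j, rfl⟩
  · have h1 := h.flow_out
    simp only [Set.mem_singleton_iff, finsum_cond_eq_left] at h1
    have h2 : ∀ y, ((treeGraph e.1).Adj [] y ∧ y ≠ []) ↔ (treeGraph e.1).Adj [] y := fun y =>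
      and_iff_left_of_imp fun h => h.ne'
    simp only [h2, finsum_treeGraph_adj_nil] at h1
    simp [NetworkFlow.above, h1]
  · rw [List.concat_eq_append] at *
    have h1 := h.node_law (p ++ [j]) (by
      rintro (h | h)
      · simp at h
      · exact hn.ne h.2)
    rw [NetworkFlow.div, finsum_treeGraph_adj_append hx, θ.antisymm] at h1
    rw [θ.above_append]
    linarith

/-! ### The unit current as an optimal flow on the tree. -/

namespace TreeEnv

variable {lam : ℝ}

open Classical in
/-- The unit current from the root to the `n`-th level, as a flow on the tree. -/
def currentFlow (lam : ℝ) (n : ℕ) (e : TreeEnv) : NetworkFlow (treeGraph e.1) where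
  toFun x y :=
    if (treeGraph e.1).Adj x y then
      if x.length < y.length then unitCurrent lam n e y else -unitCurrent lam n e x
    else 0
  antisymm x y := by
    by_cases h : (treeGraph e.1).Adj x y
    · rcases lt_or_gt_of_ne (treeGraph_adj_length h) with h' | h'
      · simp [h, h.symm, h', not_lt_of_gt h']
      · simp [h, h.symm, h', not_lt_of_gt h']
    · have h' : ¬ (treeGraph e.1).Adj y x := fun h' => h h'.symm
      simp [h, h']
  eq_zero_of_not_adj x y h := by simp [h]

lemma currentFlow_append {n : ℕ} {e : TreeEnv} {x : List ℕ} {i : ℕ}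
    (hx : x ++ [i] ∈ wordTree e.1) :
    (currentFlow lam n e).toFun x (x ++ [i]) = unitCurrent lam n e (x ++ [i]) := by
  simp [currentFlow, treeGraph_adj_append hx]

lemma currentFlow_div_append {n : ℕ} {e : TreeEnv} {p : List ℕ} {j : ℕ}
    (hx : p ++ [j] ∈ wordTree e.1) : (currentFlow lam n e).div (p ++ [j]) =
      -unitCurrent lam n e (p ++ [j]) +
        ∑ i ∈ Finset.range (e.1 (p ++ [j])), unitCurrent lam n e (p ++ [j] ++ [i]) := by
  rw [NetworkFlow.div, finsum_treeGraph_adj_append hx, NetworkFlow.antisymm,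
    currentFlow_append hx]
  congr 1
  exact Finset.sum_congr rfl fun i hi => currentFlow_append
    (append_singleton_mem_wordTree.2 ⟨hx, Finset.mem_range.1 hi⟩)

lemma sum_unitCurrent_append_of_le {n : ℕ} {e : TreeEnv} {x : List ℕ} (h : n ≤ x.length) :
    ∑ i ∈ Finset.range (e.1 x), unitCurrent lam n e (x ++ [i]) = 0 :=
  Finset.sum_eq_zero fun i _ => unitCurrent_of_lt (by simpa using Nat.lt_succ_of_le h)

lemma currentFlow_isUnitFlow (hl : 0 < lam) (n : ℕ) {e : TreeEnv} (he : e.Regular) :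
    (currentFlow lam (n + 1) e).IsUnitFlow {[]} (treeLevel e.1 (n + 1)) where
  node_law x hx := by
    simp only [Set.mem_union, Set.mem_singleton_iff, not_or] at hx
    by_cases hw : x ∈ wordTree e.1
    · rcases List.eq_nil_or_concat x with rfl | ⟨p, j, rfl⟩
      · exact absurd rfl hx.1
      · rw [List.concat_eq_append] at *
        rw [currentFlow_div_append hw]
        rcases lt_trichotomy (p ++ [j]).length (n + 1) with h | h | h
        · rw [← unitCurrent_nodeLaw hl (n + 1) he _ hw h, neg_add_cancel]
        · exact absurd ⟨hw, h⟩ hx.2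
        · rw [unitCurrent_of_lt h, sum_unitCurrent_append_of_le h.le, neg_zero, add_zero]
    · have h : ∀ y, ¬ (treeGraph e.1).Adj x y := fun y h => hw h.1
      simp [NetworkFlow.div, h]
  flow_out := by
    have h2 : ∀ y, ((treeGraph e.1).Adj [] y ∧ y ≠ []) ↔ (treeGraph e.1).Adj [] y := fun y =>
      and_iff_left_of_imp fun h => h.ne'
    simp only [Set.mem_singleton_iff, finsum_cond_eq_left, h2, finsum_treeGraph_adj_nil]
    rw [← unitCurrent_nil (lam := lam) (n + 1) e,
      unitCurrent_nodeLaw hl (n + 1) he [] (nil_mem_wordTree _) (by simp)]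
    exact Finset.sum_congr rfl fun i hi => currentFlow_append (x := [])
      (append_singleton_mem_wordTree.2 ⟨nil_mem_wordTree _, Finset.mem_range.1 hi⟩)
  flow_in := by
    have h : ∀ z ∈ treeLevel e.1 (n + 1), ∑ᶠ (y) (_ : (treeGraph e.1).Adj z y ∧
        y ∉ treeLevel e.1 (n + 1)), (currentFlow lam (n + 1) e).toFun y z =
          unitCurrent lam (n + 1) e z := by
      rintro z ⟨hz, hn⟩
      have h2 : ∀ y, ((treeGraph e.1).Adj z y ∧ y ∉ treeLevel e.1 (n + 1)) ↔
          (treeGraph e.1).Adj z y := fun y =>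
        and_iff_left_of_imp fun h hy => treeGraph_adj_length h (hn.trans hy.2.symm)
      simp only [h2]
      rcases List.eq_nil_or_concat z with rfl | ⟨p, j, rfl⟩
      · simp at hn
      · rw [List.concat_eq_append] at *
        -- The current vanishes beyond the target level, so only the edge from the parent
        -- contributes.
        rw [finsum_treeGraph_adj_append hz, currentFlow_append hz, add_eq_left]
        refine Finset.sum_eq_zero fun i hi => ?_
        rw [NetworkFlow.antisymm, currentFlow_append
          (append_singleton_mem_wordTree.2 ⟨hz, Finset.mem_range.1 hi⟩),
          unitCurrent_of_lt (by rw [List.length_append, hn]; simp), neg_zero]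
    rw [finsum_mem_congr rfl h, ← coe_levelFinset, finsum_mem_coe_finset,
      sum_level_unitCurrent hl (n + 1) he]

lemma wordEnergy_currentFlow (n : ℕ) (e : TreeEnv) (x : List ℕ) :
    wordEnergy lam e (currentFlow lam n e).above x = wordEnergy lam e (unitCurrent lam n e) x := by
  rcases List.eq_nil_or_concat x with rfl | ⟨p, j, rfl⟩
  · simp [wordEnergy]
  · rw [List.concat_eq_append, wordEnergy, wordEnergy]
    split_ifs with h
    · rw [NetworkFlow.above_append, currentFlow_append h.2]
    · rfl

/-- The conductances of the first levels of a tree are given by the series and parallel laws. -/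
lemma effectiveConductance_treeLevel (hl : 0 < lam) (n : ℕ) {e : TreeEnv} (he : e.Regular) :
    effectiveConductance (treeGraph e.1) (edgeResistance lam e.2) {[]} (treeLevel e.1 (n + 1)) =
      ENNReal.ofReal (conductanceSeq lam card mark shift n e) := by
  have hA := conductanceSeq_pos hl n he
  have hR : effectiveResistance (treeGraph e.1) (edgeResistance lam e.2) {[]}
      (treeLevel e.1 (n + 1)) =
      ENNReal.ofReal (conductanceSeq lam card mark shift n e)⁻¹ := by
    refine le_antisymm ?_ (le_iInf₂ fun θ hθ => ?_)
    · refine iInf₂_le_of_le _ (currentFlow_isUnitFlow hl n he) (le_of_eq ?_)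
      rw [NetworkFlow.energy_eq_tsum, tsum_congr (wordEnergy_currentFlow (n + 1) e),
        tsum_wordEnergy_unitCurrent hl n he]
    · rw [NetworkFlow.energy_eq_tsum]
      simpa [NetworkFlow.above] using conductanceSeq_energy_le hl n he hθ.nodeLaw
  rw [effectiveConductance, hR, ENNReal.ofReal_inv_of_pos hA, inv_inv]

/-- The sizes of the levels of a tree. -/
lemma ncard_treeLevel (n : ℕ) (e : TreeEnv) :
    ((treeLevel e.1 n).ncard : ℝ) = (offspringSum card shift)^[n] (fun _ => 1) e := by
  rw [← coe_levelFinset, Set.ncard_coe_finset]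
  induction n generalizing e with
  | zero => simp [levelFinset]
  | succ n ih =>
    rw [Finset.card_eq_sum_ones, sum_levelFinset_succ, Function.iterate_succ_apply', offspringSum]
    push_cast
    refine Finset.sum_congr rfl fun i _ => ?_
    rw [← ih]
    simp [shift]

end TreeEnv

/-! ### Conductances of branching networks -/

namespace IsBranchingNetwork

variable {Ω : Type*} [MeasurableSpace Ω] {P : Measure Ω}
  {ν : List ℕ → Ω → ℕ} {ξ : List ℕ → Ω → ℝ} {m lam : ℝ}

lemma ae_regular (h : IsBranchingNetwork P ν ξ) (hp₀ : ∀ᵐ ω ∂P, ν [] ω ≠ 0)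
    (hξ : ∀ᵐ ω ∂P, 0 < ξ [] ω) : ∀ᵐ ω ∂P, (treeEnv ν ξ ω).Regular := by
  refine ae_all_iff.2 fun x => ?_
  filter_upwards [(h.identDistrib_factor x).symm.ae_mem_snd measurableSet_Ioi hξ,
    (h.identDistrib_offspring x).symm.ae_mem_snd (t := {0}ᶜ) (MeasurableSet.of_discrete) hp₀]
    with ω h1 h2 using ⟨h1, h2⟩

lemma isSupercritical (h : IsBranchingNetwork P ν ξ) (hp₀ : ∀ᵐ ω ∂P, ν [] ω ≠ 0)
    (hξ : ∀ᵐ ω ∂P, 0 < ξ [] ω) (hm : m = ∫ ω, (ν [] ω : ℝ) ∂P) (hm₁ : 1 < m)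
    (h₁ : Integrable (ξ []) P) (h₂ : Integrable (fun ω => (ξ [] ω)⁻¹) P)
    (h₃ : Integrable (fun ω => (ν [] ω : ℝ) ^ 2) P) :
    BranchingSystem.IsSupercritical (P.map (treeEnv ν ξ)) TreeEnv.card TreeEnv.mark m := by
  have hmeas := h.measurable_treeEnv
  have hc : Measurable fun e : TreeEnv => (e.card : ℝ) :=
    measurable_from_nat.comp TreeEnv.measurable_card
  exact
  { card_ne_zero := (ae_map_iff hmeas.aemeasurable
      (TreeEnv.measurable_card (MeasurableSet.of_discrete (s := {0}ᶜ)))).2 hp₀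
    mark_pos := (ae_map_iff hmeas.aemeasurable
      (TreeEnv.measurable_mark measurableSet_Ioi)).2 hξ
    memLp_card := (memLp_map_measure_iff hc.aestronglyMeasurable hmeas.aemeasurable).2
      ((memLp_two_iff_integrable_sq (hc.comp hmeas).aestronglyMeasurable).2 h₃)
    integrable_mark := (integrable_map_measure
      TreeEnv.measurable_mark.aestronglyMeasurable hmeas.aemeasurable).2 h₁
    integrable_inv_mark := (integrable_map_measure
      TreeEnv.measurable_mark.inv.aestronglyMeasurable hmeas.aemeasurable).2 h₂
    mean := by
      rw [hm, integral_map hmeas.aemeasurable hc.aestronglyMeasurable]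
      rfl
    one_lt := hm₁ }

lemma ae_levelConductance_eq (h : IsBranchingNetwork P ν ξ) (hp₀ : ∀ᵐ ω ∂P, ν [] ω ≠ 0)
    (hξ : ∀ᵐ ω ∂P, 0 < ξ [] ω) (hl : 0 < lam) : ∀ᵐ ω ∂P, ∀ n,
      levelConductance ν ξ lam (n + 1) ω =
        conductanceSeq lam TreeEnv.card TreeEnv.mark TreeEnv.shift n (treeEnv ν ξ ω) := by
  filter_upwards [h.ae_regular hp₀ hξ] with ω hω n
  have := TreeEnv.effectiveConductance_treeLevel hl n hω
  rw [levelConductance]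
  exact (congrArg ENNReal.toReal this).trans
    (ENNReal.toReal_ofReal (TreeEnv.conductanceSeq_pos hl n hω).le)

lemma integral_levelConductance [IsProbabilityMeasure P] (h : IsBranchingNetwork P ν ξ)
    (hp₀ : ∀ᵐ ω ∂P, ν [] ω ≠ 0)
    (hξ : ∀ᵐ ω ∂P, 0 < ξ [] ω) (hl : 0 < lam) (n : ℕ) :
    ∫ ω, levelConductance ν ξ lam (n + 1) ω ∂P =
      ∫ e, conductanceSeq lam TreeEnv.card TreeEnv.mark TreeEnv.shift n e
        ∂(P.map (treeEnv ν ξ)) := by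
  rw [integral_map h.measurable_treeEnv.aemeasurable
    (h.branchingSystem.measurable_conductanceSeq n).aestronglyMeasurable]
  exact integral_congr_ae ((h.ae_levelConductance_eq hp₀ hξ hl).mono fun ω hω => hω n)

/-- The conductances of a supercritical branching network with `ν` square integrable, `ξ` and `ξ⁻¹`
integrable: integrability, almost sure convergence, and growth of the mean. -/
lemma conductance_growth [IsProbabilityMeasure P] (h : IsBranchingNetwork P ν ξ)
    (hp₀ : ∀ᵐ ω ∂P, ν [] ω ≠ 0)
    (hξ : ∀ᵐ ω ∂P, 0 < ξ [] ω) (hm : m = ∫ ω, (ν [] ω : ℝ) ∂P) (hm₁ : 1 < m) (hlam : m < lam)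
    (h₁ : Integrable (ξ []) P) (h₂ : Integrable (fun ω => (ξ [] ω)⁻¹) P)
    (h₃ : Integrable (fun ω => (ν [] ω : ℝ) ^ 2) P) :
    (∀ n, 1 ≤ n → Integrable (levelConductance ν ξ lam n) P ∧
      0 < ∫ ω, levelConductance ν ξ lam n ω ∂P) ∧
    (∀ᵐ ω ∂P,
      Tendsto (fun n => normalizedLevelSize ν m n ω) atTop (𝓝 (levelSizeLimit ν m ω)) ∧
      Tendsto (fun n => levelConductance ν ξ lam n ω / ∫ ω', levelConductance ν ξ lam n ω' ∂P)
        atTop (𝓝 (levelSizeLimit ν m ω))) ∧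
    ∃ L : ℝ, 0 < L ∧
      Tendsto (fun n : ℕ => (lam / m) ^ n * ∫ ω, levelConductance ν ξ lam n ω ∂P)
        atTop (𝓝 L) := by
  have hm₀ : 0 < m := by linarith
  have hl : 0 < lam := hm₀.trans hlam
  have hmeas := h.measurable_treeEnv
  have : IsProbabilityMeasure (P.map (treeEnv ν ξ)) :=
    Measure.isProbabilityMeasure_map hmeas.aemeasurable
  have S := h.branchingSystem
  have H := h.isSupercritical hp₀ hξ hm hm₁ h₁ h₂ h₃
  have hae := h.ae_levelConductance_eq hp₀ hξ hl
  have hint := h.integral_levelConductance hp₀ hξ hl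
  refine ⟨fun n hn => ?_, ?_, ?_⟩
  · obtain ⟨n, rfl⟩ := Nat.exists_eq_add_of_le' hn
    refine ⟨?_, hint n ▸ S.integral_conductanceSeq_pos H hlam n⟩
    exact ((integrable_map_measure (S.measurable_conductanceSeq n).aestronglyMeasurable
      hmeas.aemeasurable).1 (S.integrable_conductanceSeq H hlam n).1).congr
        (hae.mono fun ω hω => (hω n).symm)
  · filter_upwards [hae, ae_of_ae_map hmeas.aemeasurable
      (S.ae_tendsto_conductanceSeq_div_mean H hlam)] with ω hω ⟨w, hw, hw'⟩
    have hsize : Tendsto (fun n => normalizedLevelSize ν m n ω) atTop (𝓝 w) := by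
      refine hw.congr fun n => ?_
      rw [← TreeEnv.ncard_treeLevel, normalizedLevelSize, div_eq_inv_mul]
      rfl
    have hlim : levelSizeLimit ν m ω = w := hsize.limUnder_eq
    rw [hlim]
    refine ⟨hsize, (tendsto_add_atTop_iff_nat 1).1 (hw'.congr fun n => ?_)⟩
    rw [hω, hint]
  · obtain ⟨L, hL, hlim⟩ := S.exists_tendsto_normalized_mean H hlam
    -- The factor `lam / m` comes from the index shift: `conductanceSeq` at `n` is the conductance
    -- to level `n + 1`.
    refine ⟨lam / m * L, by positivity, (tendsto_add_atTop_iff_nat 1).1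
      ((hlim.const_mul (lam / m)).congr fun n => ?_)⟩
    rw [hint, pow_succ, div_pow, div_pow]
    field_simp

end IsBranchingNetwork

end

/-! ### The main theorem. -/

theorem theorem5 {Ω : Type*} [MeasurableSpace Ω] (P : Measure Ω) [IsProbabilityMeasure P]
    (ν : List ℕ → Ω → ℕ) (ξ : List ℕ → Ω → ℝ) (hnet : IsBranchingNetwork P ν ξ)
    (hp₀ : ∀ᵐ ω ∂P, ν [] ω ≠ 0) (hξ : ∀ᵐ ω ∂P, 0 < ξ [] ω)
    (m : ℝ) (hm : m = ∫ ω, (ν [] ω : ℝ) ∂P) (hm₁ : 1 < m)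
    (lam : ℝ) (hlam : m < lam) :
    (Integrable (fun ω => ξ [] ω + (ξ [] ω)⁻¹ + (ν [] ω : ℝ) ^ 2) P →
      (∀ n, 1 ≤ n → Integrable (levelConductance ν ξ lam n) P ∧
        0 < ∫ ω, levelConductance ν ξ lam n ω ∂P) ∧
      ∀ᵐ ω ∂P,
        Tendsto (fun n => normalizedLevelSize ν m n ω) atTop (𝓝 (levelSizeLimit ν m ω)) ∧
        Tendsto (fun n => levelConductance ν ξ lam n ω / ∫ ω', levelConductance ν ξ lam n ω' ∂P)
          atTop (𝓝 (levelSizeLimit ν m ω))) ∧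
    (Integrable (fun ω => ξ [] ω ^ 2 + (ξ [] ω)⁻¹ + (ν [] ω : ℝ) ^ 3) P →
      (∀ n, 1 ≤ n → Integrable (levelConductance ν ξ lam n) P) ∧
      ∃ L : ℝ, 0 < L ∧
        Tendsto (fun n : ℕ => (lam / m) ^ n * ∫ ω, levelConductance ν ξ lam n ω ∂P)
          atTop (𝓝 L)) := by
  have hξm := hnet.measurable_factor []
  have hνm : Measurable fun ω => (ν [] ω : ℝ) :=
    measurable_from_nat.comp (hnet.measurable_offspring [])
  constructor
  · intro hI
    obtain ⟨h1, h2, -⟩ := hnet.conductance_growth hp₀ hξ hm hm₁ hlam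
      (hI.mono' hξm.aestronglyMeasurable (by
        filter_upwards [hξ] with ω hω
        rw [Real.norm_of_nonneg hω.le, add_assoc]
        exact le_add_of_nonneg_right (by positivity)))
      (hI.mono' hξm.inv.aestronglyMeasurable (by
        filter_upwards [hξ] with ω hω
        rw [Real.norm_of_nonneg (by positivity), add_right_comm]
        exact le_add_of_nonneg_left (by positivity)))
      (hI.mono' (hνm.pow_const 2).aestronglyMeasurable (by
        filter_upwards [hξ] with ω hω
        rw [Real.norm_of_nonneg (by positivity)]
        exact le_add_of_nonneg_left (by positivity)))
    exact ⟨h1, h2⟩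
  · intro hI
    obtain ⟨h1, -, h3⟩ := hnet.conductance_growth hp₀ hξ hm hm₁ hlam
      -- The added constant serves the bound $\xi\le\xi^2+1$.
      ((hI.add (integrable_const 1)).mono' hξm.aestronglyMeasurable (by
        filter_upwards [hξ] with ω hω
        rw [Real.norm_of_nonneg hω.le, Pi.add_apply]
        have : 0 < (ξ [] ω)⁻¹ := by positivity
        have : 0 ≤ (ν [] ω : ℝ) ^ 3 := by positivity
        nlinarith [sq_nonneg (ξ [] ω - 1)]))
      (hI.mono' hξm.inv.aestronglyMeasurable (by
        filter_upwards [hξ] with ω hω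
        rw [Real.norm_of_nonneg (by positivity), add_right_comm]
        exact le_add_of_nonneg_left (by positivity)))
      (hI.mono' (hνm.pow_const 2).aestronglyMeasurable (by
        filter_upwards [hξ, hp₀] with ω hω hν
        -- As there are no leaves, $\nu\ge1$ and hence $\nu^2\le\nu^3$.
        have h1 : (1 : ℝ) ≤ ν [] ω := by exact_mod_cast Nat.one_le_iff_ne_zero.2 hν
        rw [Real.norm_of_nonneg (by positivity)]
        exact (pow_le_pow_right₀ h1 (by norm_num)).trans
          (le_add_of_nonneg_left (by positivity))))
    exact ⟨fun n hn => (h1 n hn).1, h3⟩
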